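/- For $\lambda\in\mathbb R$ consider the following five families of $7$-dimensional real nilpotent Lie algebras, given in a basis $x_1,\dots,x_7$ by their brackets (brackets of basis vectors that are not listed and do not follow by antisymmetry are zero): - $123457I$ ($\lambda\in\mathbb R$): $[x_1,x_i]=x_{i+1}$ for $2\le i\le 6$, $[x_2,x_3]=x_5$, $[x_2,x_4]=x_6$, $[x_2,x_5]=\lambda x_7$, $[x_3,x_4]=(1-\lambda)x_7$. - $12457N$ ($\lambda\in\mathbb R$): $[x_1,x_2]=x_3$, $[x_1,x_3]=x_4$, $[x_1,x_4]=x_7$, $[x_1,x_5]=x_6$, $[x_1,x_6]=x_7$, $[x_2,x_3]=x_5$, $[x_2,x_4]=x_6$, $[x_2,x_5]=\lambda x_7$, $[x_2,x_6]=x_7$, $[x_3,x_4]=x_7$, $[x_3,x_5]=-x_7$. - $12457N_2$ ($\lambda\in\mathbb R$): $[x_1,x_2]=x_3$, $[x_1,x_3]=x_4$, $[x_1,x_4]=-x_6$, $[x_1,x_5]=x_7$, $[x_1,x_6]=x_7$, $[x_2,x_3]=x_5$, $[x_2,x_4]=x_7$, $[x_2,x_5]=-x_6+\lambda x_7$, $[x_3,x_5]=-x_7$.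 - $1357M$ ($\lambda\in\mathbb R\setminus\{0\}$): $[x_1,x_2]=x_3$, $[x_1,x_i]=x_{i+2}$ for $i=3,4,5$, $[x_2,x_4]=x_5$, $[x_2,x_6]=\lambda x_7$, $[x_3,x_4]=(1-\lambda)x_7$. - $1357N$ ($\lambda\in\mathbb R$): $[x_1,x_2]=x_3$, $[x_1,x_i]=x_{i+2}$ for $i=3,4,5$, $[x_2,x_3]=\lambda x_7$, $[x_2,x_4]=x_5$, $[x_3,x_4]=x_7$, $[x_4,x_6]=x_7$. Let $(\mathfrak g(\lambda))_\lambda$ be any one of these families. Then there is a finite set $S\subset\mathbb R$ such that for all admissible parameters $s,t\notin S$ the Lie algebra cohomology algebras $H^*(\mathfrak g(s),\mathbb R)$ and $H^*(\mathfrak g(t),\mathbb R)$ (trivial real coefficients, cup product) are isomorphic as graded unital $\mathbb R$-algebras. -/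

import Mathlib

open scoped TensorProduct

noncomputable section

/-! ## Cohomology algebra of a finite-dimensional real Lie algebra -/

namespace LieCohomology

/-- The Chevalley-Eilenberg cochains with trivial real coefficients, as an algebra under the wedge
product: the exterior algebra of the dual space of `L`. -/
abbrev Cochains (L : Type*) [LieRing L] [LieAlgebra ℝ L] : Type _ :=
  ExteriorAlgebra ℝ (Module.Dual ℝ L)

section

variable (L : Type*) [LieRing L] [LieAlgebra ℝ L]

/-- The canonical map `L* ⊗ L* → Λ L*`, `f ⊗ g ↦ f ∧ g`. -/
def wedge₂ : Module.Dual ℝ L ⊗[ℝ] Module.Dual ℝ L →ₗ[ℝ] Cochains L :=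
  LinearMap.mul' ℝ (Cochains L) ∘ₗ
    TensorProduct.map (ExteriorAlgebra.ι ℝ) (ExteriorAlgebra.ι ℝ)

lemma wedge₂_tmul (f g : Module.Dual ℝ L) :
    wedge₂ L (f ⊗ₜ g) = ExteriorAlgebra.ι ℝ f * ExteriorAlgebra.ι ℝ g := by
  simp [wedge₂]

lemma ι_anticomm (f g : Module.Dual ℝ L) :
    ExteriorAlgebra.ι ℝ f * ExteriorAlgebra.ι ℝ g =
      -(ExteriorAlgebra.ι ℝ g * ExteriorAlgebra.ι ℝ f) :=
  eq_neg_of_add_eq_zero_left (ExteriorAlgebra.ι_add_mul_swap f g)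

lemma wedge₂_commute (z : Module.Dual ℝ L ⊗[ℝ] Module.Dual ℝ L) (v : Module.Dual ℝ L) :
    wedge₂ L z * ExteriorAlgebra.ι ℝ v = ExteriorAlgebra.ι ℝ v * wedge₂ L z := by
  induction z using TensorProduct.induction_on with
  | zero => simp
  | tmul f g =>
    rw [wedge₂_tmul, mul_assoc, ι_anticomm L g v, mul_neg, ← mul_assoc, ι_anticomm L f v, neg_mul,
      neg_neg, mul_assoc]
  | add x y hx hy => rw [map_add, add_mul, mul_add, hx, hy]

lemma wedge₂_involute (z : Module.Dual ℝ L ⊗[ℝ] Module.Dual ℝ L) :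
    CliffordAlgebra.involute (wedge₂ L z) = wedge₂ L z := by
  induction z using TensorProduct.induction_on with
  | zero => simp
  | tmul f g =>
    rw [wedge₂_tmul, map_mul]
    erw [CliffordAlgebra.involute_ι, CliffordAlgebra.involute_ι]
    rw [neg_mul_neg]
  | add x y hx hy => rw [map_add, map_add, hx, hy]

variable [Module.Finite ℝ L]

/-- The differential on one-forms, `(d f)(x, y) = -f ⁅x, y⁆`. The bilinear form `f ⁅x, y⁆` is first
read as an element of `L* ⊗ L*`; the factor `1/2` is there because the two-form
`f ∧ g` is `(x, y) ↦ f x * g y - f y * g x`. See `dDual_eq_sum` for the formula in a basis. -/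
def dDual : Module.Dual ℝ L →ₗ[ℝ] Cochains L :=
  (-(1 / 2) : ℝ) • (wedge₂ L ∘ₗ (TensorProduct.dualDistribEquiv ℝ L L).symm.toLinearMap ∘ₗ
    Module.Dual.transpose (LieModule.toModuleHom ℝ L L : L ⊗[ℝ] L →ₗ[ℝ] L))

lemma dDual_mem (f : Module.Dual ℝ L) : ∃ z, dDual L f = wedge₂ L z :=
  ⟨(-(1 / 2) : ℝ) • (TensorProduct.dualDistribEquiv ℝ L L).symm
    (Module.Dual.transpose (LieModule.toModuleHom ℝ L L : L ⊗[ℝ] L →ₗ[ℝ] L) f),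
    by simp only [dDual, map_smul]; rfl⟩

lemma dDual_commute (f v : Module.Dual ℝ L) :
    dDual L f * ExteriorAlgebra.ι ℝ v = ExteriorAlgebra.ι ℝ v * dDual L f := by
  obtain ⟨z, hz⟩ := dDual_mem L f
  rw [hz, wedge₂_commute]

lemma dDual_eq_sum {ι : Type*} [Fintype ι] (b : Module.Basis ι ℝ L) (f : Module.Dual ℝ L) :
    dDual L f = (-(1 / 2) : ℝ) • ∑ i, ∑ j, f ⁅b i, b j⁆ •
      (ExteriorAlgebra.ι ℝ (b.coord i) * ExteriorAlgebra.ι ℝ (b.coord j)) := by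
  classical
  have key : (TensorProduct.dualDistribEquiv ℝ L L).symm
      (Module.Dual.transpose (LieModule.toModuleHom ℝ L L : L ⊗[ℝ] L →ₗ[ℝ] L) f) =
      ∑ i, ∑ j, f ⁅b i, b j⁆ • (b.coord i ⊗ₜ[ℝ] b.coord j) := by
    rw [LinearEquiv.symm_apply_eq]
    refine (b.tensorProduct b).ext fun ⟨k, l⟩ => ?_
    simp only [map_sum, map_smul]
    simp [TensorProduct.dualDistribEquiv, TensorProduct.dualDistribEquivOfBasis,
      Finsupp.single_apply, Module.Dual.transpose_apply]
  have h2 : dDual L f = (-(1 / 2) : ℝ) • wedge₂ L ((TensorProduct.dualDistribEquiv ℝ L L).symm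
      (Module.Dual.transpose (LieModule.toModuleHom ℝ L L : L ⊗[ℝ] L →ₗ[ℝ] L) f)) := rfl
  rw [h2, key]
  simp only [map_sum, map_smul, wedge₂_tmul]

/-- The algebra homomorphism `a ↦ !![±a, d a; 0, a]` that encodes the extension of `dDual` to an
antiderivation. -/
def dHom : Cochains L →ₐ[ℝ] Matrix (Fin 2) (Fin 2) (Cochains L) :=
  ExteriorAlgebra.lift ℝ
    ⟨{ toFun := fun v => !![-ExteriorAlgebra.ι ℝ v, dDual L v; 0, ExteriorAlgebra.ι ℝ v]
       map_add' := fun v w => by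
        ext i j; fin_cases i <;> fin_cases j <;> simp [add_comm]
       map_smul' := fun c v => by
        ext i j; fin_cases i <;> fin_cases j <;> simp },
      fun v => by
        ext i j
        fin_cases i <;> fin_cases j <;> simp [Matrix.mul_apply, dDual_commute]⟩

/-- The Chevalley-Eilenberg differential: the antiderivation of `Λ L*` that extends `dDual`
(see `d_ι` and `d_mul`). -/
def d : Cochains L →ₗ[ℝ] Cochains L where
  toFun a := dHom L a 0 1
  map_add' a b := by simp
  map_smul' c a := by simp

lemma dHom_ι (v : Module.Dual ℝ L) :
    dHom L (ExteriorAlgebra.ι ℝ v) =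
      !![-ExteriorAlgebra.ι ℝ v, dDual L v; 0, ExteriorAlgebra.ι ℝ v] := by
  unfold dHom
  rw [ExteriorAlgebra.lift_ι_apply]
  rfl

lemma dHom_eq (a : Cochains L) :
    dHom L a = !![CliffordAlgebra.involute a, d L a; 0, a] := by
  suffices h : dHom L a 0 0 = CliffordAlgebra.involute a ∧ dHom L a 1 0 = 0 ∧ dHom L a 1 1 = a by
    ext i j
    fin_cases i <;> fin_cases j
    · exact h.1
    · rfl
    · exact h.2.1
    · exact h.2.2
  induction a using ExteriorAlgebra.induction with
  | algebraMap r =>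
    refine ⟨?_, ?_, ?_⟩ <;> simp [Matrix.algebraMap_matrix_apply]
  | ι v =>
    rw [dHom_ι]
    refine ⟨?_, rfl, rfl⟩
    exact (CliffordAlgebra.involute_ι v).symm
  | mul a b ha hb =>
    obtain ⟨ha1, ha2, ha3⟩ := ha
    obtain ⟨hb1, hb2, hb3⟩ := hb
    simp [Matrix.mul_apply, ha1, ha2, ha3, hb1, hb2, hb3]
  | add a b ha hb =>
    obtain ⟨ha1, ha2, ha3⟩ := ha
    obtain ⟨hb1, hb2, hb3⟩ := hb
    simp [ha1, ha2, ha3, hb1, hb2, hb3]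

lemma d_ι (v : Module.Dual ℝ L) : d L (ExteriorAlgebra.ι ℝ v) = dDual L v := by
  change dHom L (ExteriorAlgebra.ι ℝ v) 0 1 = _
  rw [dHom_ι]
  rfl

lemma d_algebraMap (r : ℝ) : d L (algebraMap ℝ _ r) = 0 := by
  change dHom L (algebraMap ℝ _ r) 0 1 = _
  simp [Matrix.algebraMap_matrix_apply]

/-- The graded Leibniz rule; `involute` is multiplication by `(-1) ^ n` in degree `n`. -/
lemma d_mul (a b : Cochains L) :
    d L (a * b) = d L a * b + CliffordAlgebra.involute a * d L b := by
  change dHom L _ 0 1 = _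
  rw [map_mul, dHom_eq, dHom_eq]
  simp [Matrix.mul_apply, add_comm]

lemma d_involute (a : Cochains L) :
    d L (CliffordAlgebra.involute a) = -CliffordAlgebra.involute (d L a) := by
  induction a using ExteriorAlgebra.induction with
  | algebraMap r =>
    rw [AlgHom.commutes, d_algebraMap, map_zero, neg_zero]
  | ι v =>
    erw [CliffordAlgebra.involute_ι]
    rw [map_neg]
    erw [d_ι]
    obtain ⟨z, hz⟩ := dDual_mem L v
    rw [hz, wedge₂_involute]
  | mul a b ha hb =>
    rw [map_mul, d_mul, d_mul, map_add, map_mul, map_mul, ha, hb]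
    simp only [CliffordAlgebra.involute_involute]
    noncomm_ring
  | add a b ha hb => simp only [map_add, ha, hb, neg_add]

lemma d_dDual (v : Module.Dual ℝ L) : d L (dDual L v) = 0 := by
  let b := Module.finBasis ℝ L
  let θ : Fin (Module.finrank ℝ L) → Cochains L := fun i => ExteriorAlgebra.ι ℝ (b.coord i)
  have hcomm : ∀ i j, dDual L (b.coord i) * θ j = θ j * dDual L (b.coord i) := fun i j =>
    dDual_commute L _ _
  have hcyc : ∀ i k l, θ k * (θ l * θ i) = θ i * (θ k * θ l) := fun i k l => by
    have h := wedge₂_commute L (b.coord k ⊗ₜ b.coord l) (b.coord i)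
    rw [wedge₂_tmul] at h
    rw [← mul_assoc]
    exact h
  have hθ : ∀ i j, d L (θ i * θ j) = dDual L (b.coord i) * θ j - θ i * dDual L (b.coord j) :=
    fun i j => by
    rw [d_mul, d_ι, d_ι]
    erw [CliffordAlgebra.involute_ι]
    rw [neg_mul, ← sub_eq_add_neg]
  have h1 : d L (dDual L v) = ∑ i, ∑ j, v ⁅b i, b j⁆ • (θ i * dDual L (b.coord j)) := by
    have e1 : d L (dDual L v) = (-(1 / 2) : ℝ) • ((∑ i, ∑ j, v ⁅b i, b j⁆ •
        (dDual L (b.coord i) * θ j)) - ∑ i, ∑ j, v ⁅b i, b j⁆ • (θ i * dDual L (b.coord j))) := by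
      rw [dDual_eq_sum L b v]
      simp only [map_smul, map_sum]
      congr 1
      rw [← Finset.sum_sub_distrib]
      refine Finset.sum_congr rfl fun i _ => ?_
      rw [← Finset.sum_sub_distrib]
      refine Finset.sum_congr rfl fun j _ => ?_
      rw [← smul_sub]
      exact congrArg _ (hθ i j)
    have e2 : (∑ i, ∑ j, v ⁅b i, b j⁆ • (dDual L (b.coord i) * θ j)) =
        -∑ i, ∑ j, v ⁅b i, b j⁆ • (θ i * dDual L (b.coord j)) := by
      rw [Finset.sum_comm, ← Finset.sum_neg_distrib]
      refine Finset.sum_congr rfl fun i _ => ?_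
      rw [← Finset.sum_neg_distrib]
      refine Finset.sum_congr rfl fun j _ => ?_
      rw [hcomm, ← lie_skew (b j) (b i), map_neg, neg_smul]
    rw [e1, e2]
    module
  let T : Cochains L := ∑ i, ∑ k, ∑ l, v ⁅b i, ⁅b k, b l⁆⁆ • (θ i * (θ k * θ l))
  have h2 : d L (dDual L v) = (-(1 / 2) : ℝ) • T := by
    rw [h1, Finset.smul_sum]
    refine Finset.sum_congr rfl fun i _ => ?_
    simp_rw [dDual_eq_sum L b (b.coord _), mul_smul_comm, Finset.mul_sum, smul_comm _ (-(1 / 2) : ℝ)]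
    rw [← Finset.smul_sum]
    congr 1
    simp_rw [Finset.smul_sum, mul_smul_comm, smul_smul]
    rw [Finset.sum_comm]
    refine Finset.sum_congr rfl fun k _ => ?_
    rw [Finset.sum_comm]
    refine Finset.sum_congr rfl fun l _ => ?_
    rw [← Finset.sum_smul]
    congr 1
    have h : v ⁅b i, ⁅b k, b l⁆⁆ = v ⁅b i, ∑ x, b.repr ⁅b k, b l⁆ x • b x⁆ := by
      rw [b.sum_repr]
    rw [h, lie_sum, map_sum]
    refine Finset.sum_congr rfl fun x _ => ?_
    rw [lie_smul, map_smul, smul_eq_mul, mul_comm]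
    rfl
  have hrot : ∀ g : Fin (Module.finrank ℝ L) → Fin (Module.finrank ℝ L) →
      Fin (Module.finrank ℝ L) → ℝ, ∑ i, ∑ k, ∑ l, g i k l • (θ i * (θ k * θ l)) =
        ∑ i, ∑ k, ∑ l, g k l i • (θ i * (θ k * θ l)) := fun g => by
    have e : ∀ i k l, g k l i • (θ i * (θ k * θ l)) = g k l i • (θ k * (θ l * θ i)) :=
      fun i k l => by rw [← hcyc i k l]
    symm
    rw [Finset.sum_congr rfl fun i _ => Finset.sum_congr rfl fun k _ =>
      Finset.sum_congr rfl fun l _ => e i k l, Finset.sum_comm]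
    refine Finset.sum_congr rfl fun k _ => ?_
    exact Finset.sum_comm
  have h3 : T = ∑ i, ∑ k, ∑ l, v ⁅b k, ⁅b l, b i⁆⁆ • (θ i * (θ k * θ l)) :=
    hrot fun i k l => v ⁅b i, ⁅b k, b l⁆⁆
  have h4 : T = ∑ i, ∑ k, ∑ l, v ⁅b l, ⁅b i, b k⁆⁆ • (θ i * (θ k * θ l)) :=
    h3.trans (hrot fun i k l => v ⁅b k, ⁅b l, b i⁆⁆)
  have h5 : T + T + T = 0 := by
    have e : T + T + T = (∑ i, ∑ k, ∑ l, v ⁅b i, ⁅b k, b l⁆⁆ • (θ i * (θ k * θ l))) +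
        (∑ i, ∑ k, ∑ l, v ⁅b k, ⁅b l, b i⁆⁆ • (θ i * (θ k * θ l))) +
        ∑ i, ∑ k, ∑ l, v ⁅b l, ⁅b i, b k⁆⁆ • (θ i * (θ k * θ l)) := by
      rw [← h3, ← h4]
    rw [e]
    simp only [← Finset.sum_add_distrib, ← add_smul, ← map_add, lie_jacobi, map_zero,
      zero_smul, Finset.sum_const_zero]
  have h6 : T = 0 := by
    have : (3 : ℝ) • T = 0 := by rw [← h5]; module
    simpa using this
  rw [h2, h6, smul_zero]

/-- The differential squares to zero. -/
lemma d_d (a : Cochains L) : d L (d L a) = 0 := by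
  induction a using ExteriorAlgebra.induction with
  | algebraMap r => rw [d_algebraMap, map_zero]
  | ι v => rw [d_ι, d_dDual]
  | mul a b ha hb =>
    rw [d_mul, map_add, d_mul, d_mul, ha, hb, d_involute, CliffordAlgebra.involute_involute]
    noncomm_ring
  | add a b ha hb => rw [map_add, map_add, ha, hb, add_zero]

/-- The subalgebra of cocycles, `ker d`. -/
def cocycles : Subalgebra ℝ (Cochains L) where
  carrier := {a | d L a = 0}
  mul_mem' {a b} ha hb := by
    simp only [Set.mem_ofPred_eq] at *
    rw [d_mul, ha, hb, zero_mul, mul_zero, add_zero]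
  add_mem' {a b} ha hb := by
    simp only [Set.mem_ofPred_eq] at *
    rw [map_add, ha, hb, add_zero]
  algebraMap_mem' r := d_algebraMap L r

/-- The ideal of coboundaries, `im d`, in the algebra of cocycles. -/
def coboundaries : Ideal (cocycles L) where
  carrier := {z | ∃ a, d L a = z}
  add_mem' := by
    rintro x y ⟨a, ha⟩ ⟨b, hb⟩
    exact ⟨a + b, by rw [map_add, ha, hb]; rfl⟩
  zero_mem' := ⟨0, by simp⟩
  smul_mem' := by
    rintro ⟨c, hc⟩ x ⟨a, ha⟩
    have hc' : d L c = 0 := hc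
    refine ⟨CliffordAlgebra.involute c * a, ?_⟩
    rw [d_mul, d_involute, hc', CliffordAlgebra.involute_involute, ha]
    simp

instance coboundaries_isTwoSided : (coboundaries L).IsTwoSided where
  mul_mem_of_left := by
    rintro x ⟨c, hc⟩ ⟨a, ha⟩
    have hc' : d L c = 0 := hc
    exact ⟨a * c, by rw [d_mul, hc', ha]; simp⟩

/-- The cohomology algebra `H^*(L, ℝ)`. -/
abbrev Cohomology : Type _ := cocycles L ⧸ coboundaries L

/-- The degree `n` part `H^n(L, ℝ)`: the classes of the cocycles in `Λ^n L*`. -/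
def Cohomology.degree (n : ℕ) : Submodule ℝ (Cohomology L) :=
  ((⋀[ℝ]^n (Module.Dual ℝ L)).comap (cocycles L).val.toLinearMap).map
    (Ideal.Quotient.mkₐ ℝ (coboundaries L)).toLinearMap

end

/-- `H^*(L, ℝ)` and `H^*(L', ℝ)` are isomorphic as graded unital real algebras. -/
def IsomorphicCohomology (L L' : Type*) [LieRing L] [LieAlgebra ℝ L] [Module.Finite ℝ L]
    [LieRing L'] [LieAlgebra ℝ L'] [Module.Finite ℝ L'] : Prop :=
  ∃ e : Cohomology L ≃ₐ[ℝ] Cohomology L',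
    ∀ n, (Cohomology.degree L n).map e.toLinearMap = Cohomology.degree L' n

end LieCohomology

/-! ## The five one-parameter families -/

/-- Names of five one-parameter families in the classification of 7-dimensional real nilpotent Lie
algebras. -/
inductive NilFamily
  | f123457I
  | f12457N
  | f12457N₂
  | f1357M
  | f1357N

namespace NilFamily

/-- The admissible parameter values. -/
def params : NilFamily → Set ℝ
  | f1357M => {0}ᶜ
  | _ => Set.univ

/-- The bracket with parameter `t` of the family in the basis `x₁, …, x₇`, which are the unit
vectors of `Fin 7 → ℝ` (so that `xᵢ` has index `i - 1`). Brackets of basis vectors that are not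
listed and do not follow by antisymmetry are zero.

* `123457I`: `[x₁,xᵢ] = xᵢ₊₁` for `i = 2,…,6`, `[x₂,x₃] = x₅`, `[x₂,x₄] = x₆`, `[x₂,x₅] = t x₇`,
  `[x₃,x₄] = (1-t) x₇`.
* `12457N`: `[x₁,x₂] = x₃`, `[x₁,x₃] = x₄`, `[x₁,x₄] = x₇`, `[x₁,x₅] = x₆`, `[x₁,x₆] = x₇`,
  `[x₂,x₃] = x₅`, `[x₂,x₄] = x₆`, `[x₂,x₅] = t x₇`, `[x₂,x₆] = x₇`, `[x₃,x₄] = x₇`,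
  `[x₃,x₅] = -x₇`.
* `12457N₂`: `[x₁,x₂] = x₃`, `[x₁,x₃] = x₄`, `[x₁,x₄] = -x₆`, `[x₁,x₅] = x₇`, `[x₁,x₆] = x₇`,
  `[x₂,x₃] = x₅`, `[x₂,x₄] = x₇`, `[x₂,x₅] = -x₆ + t x₇`, `[x₃,x₅] = -x₇`.
* `1357M`: `[x₁,x₂] = x₃`, `[x₁,xᵢ] = xᵢ₊₂` for `i = 3,4,5`, `[x₂,x₄] = x₅`, `[x₂,x₆] = t x₇`,
  `[x₃,x₄] = (1-t) x₇`.
* `1357N`: `[x₁,x₂] = x₃`, `[x₁,xᵢ] = xᵢ₊₂` for `i = 3,4,5`, `[x₂,x₃] = t x₇`, `[x₂,x₄] = x₅`,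
  `[x₃,x₄] = x₇`, `[x₄,x₆] = x₇`. -/
def bracket (F : NilFamily) (t : ℝ) (x y : Fin 7 → ℝ) : Fin 7 → ℝ :=
  let w : Fin 7 → Fin 7 → ℝ := fun i j => x i * y j - x j * y i
  match F with
  | f123457I => ![0, 0, w 0 1, w 0 2, w 0 3 + w 1 2, w 0 4 + w 1 3,
      w 0 5 + t * w 1 4 + (1 - t) * w 2 3]
  | f12457N => ![0, 0, w 0 1, w 0 2, w 1 2, w 0 4 + w 1 3,
      w 0 3 + w 0 5 + t * w 1 4 + w 1 5 + w 2 3 - w 2 4]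
  | f12457N₂ => ![0, 0, w 0 1, w 0 2, w 1 2, -w 0 3 - w 1 4,
      w 0 4 + w 0 5 + w 1 3 + t * w 1 4 - w 2 4]
  | f1357M => ![0, 0, w 0 1, 0, w 0 2 + w 1 3, w 0 3,
      w 0 4 + t * w 1 5 + (1 - t) * w 2 3]
  | f1357N => ![0, 0, w 0 1, 0, w 0 2 + w 1 3, w 0 3,
      w 0 4 + t * w 1 2 + w 2 3 + w 3 5]

/-- The member with parameter `t` of the family `F`: the vector space `ℝ⁷` with `F.bracket t`. -/
def LieAlg (_F : NilFamily) (_t : ℝ) : Type := Fin 7 → ℝ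

variable (F : NilFamily) (t : ℝ)

instance : AddCommGroup (F.LieAlg t) := inferInstanceAs (AddCommGroup (Fin 7 → ℝ))

instance : Module ℝ (F.LieAlg t) := inferInstanceAs (Module ℝ (Fin 7 → ℝ))

instance : Module.Finite ℝ (F.LieAlg t) := inferInstanceAs (Module.Finite ℝ (Fin 7 → ℝ))

lemma bracket_add_left (x y z : Fin 7 → ℝ) :
    F.bracket t (x + y) z = F.bracket t x z + F.bracket t y z := by
  funext k
  cases F <;> fin_cases k <;> simp [bracket] <;> ring

lemma bracket_add_right (x y z : Fin 7 → ℝ) :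
    F.bracket t x (y + z) = F.bracket t x y + F.bracket t x z := by
  funext k
  cases F <;> fin_cases k <;> simp [bracket] <;> ring

lemma bracket_self (x : Fin 7 → ℝ) : F.bracket t x x = 0 := by
  funext k
  cases F <;> fin_cases k <;> simp [bracket] <;> ring

lemma bracket_jacobi (x y z : Fin 7 → ℝ) :
    F.bracket t x (F.bracket t y z) =
      F.bracket t (F.bracket t x y) z + F.bracket t y (F.bracket t x z) := by
  funext k
  cases F <;> fin_cases k <;> simp [bracket] <;> ring

lemma bracket_smul (c : ℝ) (x y : Fin 7 → ℝ) :
    F.bracket t x (c • y) = c • F.bracket t x y := by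
  funext k
  cases F <;> fin_cases k <;> simp [bracket] <;> ring

instance : LieRing (F.LieAlg t) where
  bracket := F.bracket t
  add_lie := F.bracket_add_left t
  lie_add := F.bracket_add_right t
  lie_self := F.bracket_self t
  leibniz_lie := F.bracket_jacobi t

instance : LieAlgebra ℝ (F.LieAlg t) where
  lie_smul := F.bracket_smul t

lemma finrank_eq : Module.finrank ℝ (F.LieAlg t) = 7 :=
  Module.finrank_fin_fun ℝ

/-- If the first `n` coordinates of `y` vanish, so do the first `n + 1` coordinates of `⁅x, y⁆`. -/
lemma bracket_triangular (x y : Fin 7 → ℝ) (n : ℕ) (hy : ∀ k : Fin 7, (k : ℕ) < n → y k = 0)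
    (k : Fin 7) (hk : (k : ℕ) < n + 1) : F.bracket t x y k = 0 := by
  have h : ∀ j : Fin 7, j < k → y j = 0 := fun j hj => hy j (by omega)
  have h0 := h 0
  have h1 := h 1
  have h2 := h 2
  have h3 := h 3
  have h4 := h 4
  have h5 := h 5
  clear h hy hk
  cases F <;> fin_cases k <;> simp_all [bracket]

instance : LieRing.IsNilpotent (F.LieAlg t) := by
  rw [LieAlgebra.isNilpotent_iff_forall (R := ℝ)]
  intro x
  have h : ∀ n : ℕ, ∀ y : F.LieAlg t, ∀ k : Fin 7, (k : ℕ) < n →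
      ((LieAlgebra.ad ℝ (F.LieAlg t) x ^ n) y : Fin 7 → ℝ) k = 0 := by
    intro n
    induction n with
    | zero => intro y k hk; omega
    | succ n ih =>
      intro y k hk
      rw [pow_succ', Module.End.mul_apply]
      exact F.bracket_triangular t x _ n (ih y) k hk
  exact ⟨7, LinearMap.ext fun y => funext fun k => h 7 y k k.isLt⟩

end NilFamily

end

/-!
The cohomology algebra of a nilpotent Lie algebra of dimension `7` satisfies Poincaré duality: the
coefficient `ε` of the top form vanishes on coboundaries, and `(x, y) ↦ ε (x * y)` is a perfect
pairing on cohomology. Such an algebra is determined, up to isomorphism, by the numbers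
`ε (zᵢ * zⱼ * zₖ)` for a homogeneous basis `zᵢ` that contains the unit (`exists_algEquiv_of_trace`,
`LieCohomology.DualityFrame.isomorphicCohomology`). For each of the five families there are
explicit cocycles `zᵢ`, with coefficients that are polynomials in the parameter `t`, for which
these numbers are `cᵢⱼₖ * E(t)` with integers `cᵢⱼₖ` and a polynomial `E`. If `E(t) ≠ 0`, then `ε`
can be divided by `E(t)`, so that the triple products do not depend on `t` any more, and neither
does the algebra.

It remains to see that the classes of the `zᵢ` form a basis. They are independent because each
`zᵢ` has a partner that has a nonzero pairing with `zᵢ` and pairs to zero with the others. They span because of their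
number: if the differential has rank at least `r`, then the cohomology has dimension at most
`2 ^ 7 - 2 * r` (`LieCohomology.finrank_cohomology_add_le`). To bound the rank, a list of forms `wₖ`
and words `uᵢ` is given such that the matrix `ε (d wₖ * uᵢ)` is triangular; the finitely many
roots of `E` and of the diagonal entries are the excluded parameters.

All of this is a finite computation with exterior forms over `ℤ[t]`. Forms are represented by
lists of words in the generators (`Form`), on which products and differentials are immediate, and
which are only sorted to decide whether a form vanishes and to find its top coefficient. A
`Certificate` consists of the brackets, the cocycles and the forms `wₖ` with the words `uᵢ`; the
conditions `Certificate.Valid` on it are checked by evaluation, and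
`Certificate.Valid.isomorphicCohomology` draws the conclusion.
-/

noncomputable section

/-! ### Graded algebras determined by a trace form -/

/-- Two real algebras with bases `b`, `b'` containing the unit and with linear forms `τ`, `τ'` that
have the same values on triple products of basis vectors are isomorphic, if `τ'` gives a
nondegenerate pairing: the structure constants can be read off from the triple products. -/
lemma exists_algEquiv_of_trace {ι A A' : Type*} [Ring A] [Algebra ℝ A] [Ring A'] [Algebra ℝ A']
    (b : Module.Basis ι ℝ A) (b' : Module.Basis ι ℝ A') (τ : A →ₗ[ℝ] ℝ) (τ' : A' →ₗ[ℝ] ℝ)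
    (o : ι) (hb : b o = 1) (hb' : b' o = 1)
    (h : ∀ i j k, τ (b i * b j * b k) = τ' (b' i * b' j * b' k))
    (nondeg : ∀ y, (∀ i, τ' (y * b' i) = 0) → y = 0) :
    ∃ e : A ≃ₐ[ℝ] A', ∀ i, e (b i) = b' i := by
  let e : A ≃ₗ[ℝ] A' := b.equiv b' (Equiv.refl ι)
  have he : ∀ i, e (b i) = b' i := fun i => by simp [e]
  have he1 : e 1 = 1 := by rw [← hb, he, hb']
  let t₁ : A →ₗ[ℝ] A →ₗ[ℝ] A →ₗ[ℝ] ℝ :=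
    (LinearMap.mul ℝ A).compr₂ ((LinearMap.mul ℝ A).compr₂ τ)
  let t₂ : A →ₗ[ℝ] A →ₗ[ℝ] A →ₗ[ℝ] ℝ :=
    ((LinearMap.mul ℝ A').compl₁₂ e.toLinearMap e.toLinearMap).compr₂
      (((LinearMap.mul ℝ A').compr₂ τ').compl₂ e.toLinearMap)
  have ht : t₁ = t₂ := by
    refine b.ext fun i => b.ext fun j => b.ext fun k => ?_
    simp [t₁, t₂, he, h]
  have key : ∀ x y z, τ (x * y * z) = τ' (e x * e y * e z) := fun x y z =>
    congrArg (fun f : A →ₗ[ℝ] A →ₗ[ℝ] A →ₗ[ℝ] ℝ => f x y z) ht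
  have hmul : ∀ x y, e (x * y) = e x * e y := fun x y => by
    rw [← sub_eq_zero]
    refine nondeg _ fun i => ?_
    have h1 := key (x * y) 1 (b i)
    rw [mul_one, key, he1, mul_one, he] at h1
    rw [sub_mul, map_sub, h1, sub_self]
  exact ⟨AlgEquiv.ofLinearEquiv e he1 hmul, he⟩

/-! ### Poincaré duality in Lie algebra cohomology -/

namespace LieCohomology

section

variable (L : Type*) [LieRing L] [LieAlgebra ℝ L] [Module.Finite ℝ L]

/-- The class of a cocycle, as a linear map. -/
def classMap : cocycles L →ₗ[ℝ] Cohomology L :=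
  (Ideal.Quotient.mkₐ ℝ (coboundaries L)).toLinearMap

lemma classMap_surjective : Function.Surjective (classMap L) :=
  Ideal.Quotient.mk_surjective

lemma classMap_eq_zero_iff (x : cocycles L) : classMap L x = 0 ↔ ∃ a, d L a = x :=
  Ideal.Quotient.eq_zero_iff_mem

lemma classMap_mul (x y : cocycles L) : classMap L (x * y) = classMap L x * classMap L y :=
  map_mul (Ideal.Quotient.mkₐ ℝ (coboundaries L)) x y

variable {L}

/-- A linear form on the cohomology, from a linear form on the cochains that vanishes on
coboundaries. -/
lemma exists_trace (ε : Cochains L →ₗ[ℝ] ℝ) (hε : ∀ a, ε (d L a) = 0) :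
    ∃ τ : Cohomology L →ₗ[ℝ] ℝ, ∀ x : cocycles L, τ (classMap L x) = ε x := by
  have hsurj := classMap_surjective L
  have hker : LinearMap.ker (classMap L) ≤
      LinearMap.ker (ε ∘ₗ (cocycles L).val.toLinearMap) := fun x hx => by
    obtain ⟨a, ha⟩ := (classMap_eq_zero_iff L x).1 hx
    simp only [LinearMap.mem_ker, LinearMap.comp_apply]
    change ε (x : Cochains L) = 0
    rw [← ha, hε]
  refine ⟨(LinearMap.ker (classMap L)).liftQ _ hker ∘ₗ
    ((classMap L).quotKerEquivOfSurjective hsurj).symm.toLinearMap, fun x => ?_⟩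
  have : ((classMap L).quotKerEquivOfSurjective hsurj).symm (classMap L x) =
      Submodule.Quotient.mk x := by
    rw [LinearEquiv.symm_apply_eq]
    rfl
  simp only [LinearMap.comp_apply, LinearEquiv.coe_coe, this]
  rfl

/-- The dimension of the cohomology is at most `dim Λ L* - 2 r` if the differential has rank at
least `r`. -/
lemma finrank_cohomology_add_le [FiniteDimensional ℝ (Cochains L)] {r : ℕ} (w : Fin r → Cochains L)
    (hw : LinearIndependent ℝ fun k => d L (w k)) :
    Module.finrank ℝ (Cohomology L) + 2 * r ≤ Module.finrank ℝ (Cochains L) := by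
  have h1 := (classMap L).finrank_range_add_finrank_ker
  rw [LinearMap.range_eq_top.2 (classMap_surjective L), finrank_top] at h1
  have h2 := (d L).finrank_range_add_finrank_ker
  have h3 : Module.finrank ℝ (LinearMap.ker (d L)) = Module.finrank ℝ (cocycles L) := rfl
  have h4 : r ≤ Module.finrank ℝ (LinearMap.range (d L)) := by
    have : LinearIndependent ℝ fun k => (⟨d L (w k), w k, rfl⟩ : LinearMap.range (d L)) :=
      LinearIndependent.of_comp (LinearMap.range (d L)).subtype hw
    simpa using this.fintype_card_le_finrank
  have h5 : r ≤ Module.finrank ℝ (LinearMap.ker (classMap L)) := by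
    let v : Fin r → LinearMap.ker (classMap L) := fun k =>
      ⟨⟨d L (w k), d_d L _⟩, (classMap_eq_zero_iff L _).2 ⟨w k, rfl⟩⟩
    have : LinearIndependent ℝ v :=
      LinearIndependent.of_comp ((cocycles L).val.toLinearMap ∘ₗ
        (LinearMap.ker (classMap L)).subtype) hw
    simpa using this.fintype_card_le_finrank
  omega

/-- Cocycles which are homogeneous and, by their number and their pairing under `ε`, represent a
basis of the cohomology. -/
structure DualityFrame (L : Type*) [LieRing L] [LieAlgebra ℝ L] [Module.Finite ℝ L]
    (n : ℕ) {ι : Type*} [Fintype ι] (deg : ι → ℕ) (o : ι) where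
  /-- The trace form on cochains, which is the top coefficient up to a factor. -/
  ε : Cochains L →ₗ[ℝ] ℝ
  ε_d : ∀ a, ε (d L a) = 0
  ε_deg : ∀ k, k ≠ n → ∀ a ∈ ⋀[ℝ]^k (Module.Dual ℝ L), ε a = 0
  /-- The cocycles. -/
  z : ι → Cochains L
  d_z : ∀ i, d L (z i) = 0
  z_mem : ∀ i, z i ∈ ⋀[ℝ]^(deg i) (Module.Dual ℝ L)
  z_one : z o = 1
  dual : ∀ i, ∃ j, ε (z i * z j) ≠ 0 ∧ ∀ k, k ≠ i → ε (z k * z j) = 0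
  finrank_le : Module.finrank ℝ (Cohomology L) ≤ Fintype.card ι

namespace DualityFrame

variable {n : ℕ} {ι : Type*} [Fintype ι] {deg : ι → ℕ} {o : ι} (f : DualityFrame L n deg o)

/-- The cohomology class of a cocycle of the frame. -/
def cls (i : ι) : Cohomology L := classMap L ⟨f.z i, f.d_z i⟩

/-- A linear combination of the classes is determined by its pairings. -/
lemma coeff_eq_zero (τ : Cohomology L →ₗ[ℝ] ℝ) (hτ : ∀ x : cocycles L, τ (classMap L x) = f.ε x)
    (a : ι → ℝ) (i j : ι) (hij : f.ε (f.z i * f.z j) ≠ 0)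
    (hk : ∀ k, k ≠ i → f.ε (f.z k * f.z j) = 0)
    (h : τ ((∑ k, a k • f.cls k) * f.cls j) = 0) : a i = 0 := by
  have h1 : ∀ k, τ (f.cls k * f.cls j) = f.ε (f.z k * f.z j) := fun k => by
    rw [cls, cls, ← classMap_mul, hτ]; rfl
  simp only [Finset.sum_mul, smul_mul_assoc, map_sum, map_smul, h1, smul_eq_mul] at h
  rw [Finset.sum_eq_single i (fun k _ hki => by rw [hk k hki, mul_zero])
    (fun hi => absurd (Finset.mem_univ i) hi)] at h
  exact (mul_eq_zero.1 h).resolve_right hij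

lemma linearIndependent_cls : LinearIndependent ℝ f.cls := by
  obtain ⟨τ, hτ⟩ := exists_trace f.ε f.ε_d
  refine Fintype.linearIndependent_iff.2 fun a ha i => ?_
  obtain ⟨j, hij, hk⟩ := f.dual i
  exact f.coeff_eq_zero τ hτ a i j hij hk (by rw [ha, zero_mul, map_zero])

variable [FiniteDimensional ℝ (Cochains L)]

lemma card_eq_finrank (f : DualityFrame L n deg o) :
    Fintype.card ι = Module.finrank ℝ (Cohomology L) := by
  have : Module.Finite ℝ (Cohomology L) := Module.Finite.of_surjective _ (classMap_surjective L)
  exact le_antisymm f.linearIndependent_cls.fintype_card_le_finrank f.finrank_le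

/-- The classes of the cocycles of a frame, as a basis of the cohomology. -/
def basis : Module.Basis ι ℝ (Cohomology L) :=
  haveI : Nonempty ι := ⟨o⟩
  basisOfLinearIndependentOfCardEqFinrank f.linearIndependent_cls f.card_eq_finrank

lemma basis_apply (i : ι) : f.basis i = f.cls i := by simp [basis]

lemma degree_eq_span (m : ℕ) :
    Cohomology.degree L m = Submodule.span ℝ (f.basis '' {i | deg i = m}) := by
  obtain ⟨τ, hτ⟩ := exists_trace f.ε f.ε_d
  apply le_antisymm
  · rintro _ ⟨x, hx, rfl⟩
    change classMap L x ∈ _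
    have hx : (x : Cochains L) ∈ ⋀[ℝ]^m (Module.Dual ℝ L) := hx
    rw [← f.basis.sum_repr (classMap L x)]
    refine Submodule.sum_mem _ fun i _ => ?_
    by_cases hi : deg i = m
    · exact Submodule.smul_mem _ _ (Submodule.subset_span ⟨i, hi, rfl⟩)
    · -- the partner of `z i` has degree `n - deg i`, so its product with `x` is not of top degree
      obtain ⟨j, hij, hk⟩ := f.dual i
      have hdeg : deg i + deg j = n := by
        by_contra hne
        exact hij (f.ε_deg _ hne _ (SetLike.mul_mem_graded (f.z_mem i) (f.z_mem j)))
      have h0 : f.basis.repr (classMap L x) i = 0 := by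
        refine f.coeff_eq_zero τ hτ (fun k => f.basis.repr (classMap L x) k) i j hij hk ?_
        have : ∑ k, f.basis.repr (classMap L x) k • f.cls k = classMap L x := by
          simpa only [basis_apply] using f.basis.sum_repr (classMap L x)
        rw [this, cls, ← classMap_mul, hτ]
        exact f.ε_deg (m + deg j) (by omega) _ (SetLike.mul_mem_graded hx (f.z_mem j))
      rw [h0, zero_smul]
      exact Submodule.zero_mem _
  · rw [Submodule.span_le]
    rintro _ ⟨i, hi, rfl⟩
    rw [basis_apply]
    refine ⟨⟨f.z i, f.d_z i⟩, ?_, rfl⟩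
    have hi : deg i = m := hi
    change f.z i ∈ ⋀[ℝ]^m (Module.Dual ℝ L)
    rw [← hi]
    exact f.z_mem i

/-- Lie algebras with frames of the same degrees and the same traces of triple products have
isomorphic cohomology algebras. -/
lemma isomorphicCohomology {L' : Type*} [LieRing L'] [LieAlgebra ℝ L'] [Module.Finite ℝ L']
    [FiniteDimensional ℝ (Cochains L')] (f' : DualityFrame L' n deg o)
    (h : ∀ i j k, f.ε (f.z i * f.z j * f.z k) = f'.ε (f'.z i * f'.z j * f'.z k)) :
    IsomorphicCohomology L L' := by
  obtain ⟨τ, hτ⟩ := exists_trace f.ε f.ε_d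
  obtain ⟨τ', hτ'⟩ := exists_trace f'.ε f'.ε_d
  have one : f.basis o = 1 := by
    rw [basis_apply, cls]
    have : (⟨f.z o, f.d_z o⟩ : cocycles L) = 1 := Subtype.ext f.z_one
    rw [this]
    exact map_one (Ideal.Quotient.mkₐ ℝ (coboundaries L))
  have one' : f'.basis o = 1 := by
    rw [basis_apply, cls]
    have : (⟨f'.z o, f'.d_z o⟩ : cocycles L') = 1 := Subtype.ext f'.z_one
    rw [this]
    exact map_one (Ideal.Quotient.mkₐ ℝ (coboundaries L'))
  obtain ⟨e, he⟩ := exists_algEquiv_of_trace f.basis f'.basis τ τ' o one one'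
    (fun i j k => by
      simp only [basis_apply, cls, ← classMap_mul, hτ, hτ']
      exact h i j k)
    (fun y hy => by
      rw [← f'.basis.sum_repr y]
      refine Finset.sum_eq_zero fun i _ => ?_
      obtain ⟨j, hij, hk⟩ := f'.dual i
      have : f'.basis.repr y i = 0 := by
        refine f'.coeff_eq_zero τ' hτ' (fun k => f'.basis.repr y k) i j hij hk ?_
        have h1 : ∑ k, f'.basis.repr y k • f'.cls k = y := by
          simpa only [basis_apply] using f'.basis.sum_repr y
        rw [h1, ← basis_apply]
        exact hy j
      rw [this, zero_smul])
  refine ⟨e, fun m => ?_⟩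
  rw [f.degree_eq_span, f'.degree_eq_span, Submodule.map_span, Set.image_image]
  congr 1
  exact Set.image_congr fun i _ => he i

end DualityFrame

end

end LieCohomology

/-! ### Forms with polynomial coefficients -/

/-- Integer polynomials in one variable, as lists of coefficients starting with the constant one. -/
abbrev IntPoly : Type := List ℤ

namespace IntPoly

/-- The sum of two coefficient lists. -/
def add : IntPoly → IntPoly → IntPoly
  | [], q => q
  | p, [] => p
  | a :: p, b :: q => (a + b) :: add p q

/-- The multiple of a coefficient list by an integer. -/
def smul (c : ℤ) (p : IntPoly) : IntPoly := p.map (c * ·)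

/-- The product of two coefficient lists. -/
def mul : IntPoly → IntPoly → IntPoly
  | [], _ => []
  | a :: p, q => add (smul a q) (0 :: mul p q)

/-- Whether all coefficients are zero. -/
def isZero (p : IntPoly) : Bool := p.all (· == 0)

/-- The integer `c` with `p = c * q`, if there is one and the last coefficient of `q` is not
zero. -/
def ratio (p q : IntPoly) : ℤ := p.getD (q.length - 1) 0 / q.getLastD 1

end IntPoly

/-- Exterior forms in generators `e i`, `i : Fin n`, with coefficients in `ℤ[t]`: formal sums of
words in the generators. A word need not be increasing, and may occur several times. -/
abbrev Form (n : ℕ) : Type := List (IntPoly × List (Fin n))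

namespace Form

variable {n : ℕ}

/-- The product of two forms. -/
def mul (F G : Form n) : Form n :=
  F.flatMap fun a => G.map fun b => (a.1.mul b.1, a.2 ++ b.2)

/-- The differential of a word by the Leibniz rule, when the generators have differential `D`. -/
def dWord (D : Fin n → Form n) : List (Fin n) → Form n
  | [] => []
  | i :: w => (D i).map (fun a => (a.1, a.2 ++ w)) ++
      (dWord D w).map fun a => (a.1.smul (-1), i :: a.2)

/-- The differential of a form, when the generators have differential `D`. -/
def d (D : Fin n → Form n) (F : Form n) : Form n :=
  F.flatMap fun a => (dWord D a.2).map fun b => (a.1.mul b.1, b.2)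

/-- Inserts a letter into an increasing word, and records the sign of the rearrangement, which is
`0` if the letter is there already. -/
def insertLetter (i : Fin n) : List (Fin n) → ℤ × List (Fin n)
  | [] => (1, [i])
  | j :: w =>
    if i < j then (1, i :: j :: w)
    else if i = j then (0, [])
    else (-(insertLetter i w).1, j :: (insertLetter i w).2)

/-- Sorts a word, and records the sign of the rearrangement, which is `0` if a letter is
repeated. -/
def sortWord : List (Fin n) → ℤ × List (Fin n)
  | [] => (1, [])
  | i :: w => ((sortWord w).1 * (insertLetter i (sortWord w).2).1,
      (insertLetter i (sortWord w).2).2)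

/-- The coefficient of `e 0 * ⋯ * e (n - 1)`. -/
def top : Form n → IntPoly
  | [] => []
  | a :: F =>
    if a.2.length = n ∧ (sortWord a.2).2.length = n then
      (a.1.smul (sortWord a.2).1).add (top F)
    else top F

/-- Adds a term whose word is increasing to a form, collecting the terms with the same word. -/
def addTerm (a : IntPoly × List (Fin n)) : Form n → Form n
  | [] => [a]
  | b :: F => if a.2 = b.2 then (a.1.add b.1, b.2) :: F else b :: addTerm a F

/-- Sorts all words and collects terms. -/
def normalize : Form n → Form n
  | [] => []
  | a :: F => addTerm (a.1.smul (sortWord a.2).1, (sortWord a.2).2) (normalize F)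

/-- Whether the form vanishes after collecting terms. -/
def isZero (F : Form n) : Bool := (normalize F).all fun a => a.1.isZero

/-- The degree of a homogeneous form. -/
def deg : Form n → ℕ
  | [] => 0
  | a :: _ => a.2.length

/-- Whether all words have the same length. -/
def isHomogeneous (F : Form n) : Bool := F.all fun a => a.2.length == F.deg

end Form

/-! ### Evaluation of polynomials and forms -/

namespace IntPoly

/-- The value of a polynomial at `t`. -/
def eval (t : ℝ) : IntPoly → ℝ
  | [] => 0
  | a :: p => a + t * eval t p

variable (t : ℝ) (p q : IntPoly)

@[simp] lemma eval_nil : eval t [] = 0 := rfl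

@[simp] lemma eval_cons (a : ℤ) : eval t (a :: p) = a + t * eval t p := rfl

@[simp] lemma eval_add : (p.add q).eval t = p.eval t + q.eval t := by
  induction p generalizing q with
  | nil => simp [add]
  | cons a p ih =>
    cases q with
    | nil => simp [add]
    | cons b q => simp only [add, eval_cons, ih]; push_cast; ring

@[simp] lemma eval_smul (c : ℤ) : (p.smul c).eval t = c * p.eval t := by
  induction p with
  | nil => simp [smul]
  | cons a p ih =>
    have : smul c (a :: p) = (c * a) :: smul c p := rfl
    rw [this, eval_cons, eval_cons, ih]; push_cast; ring

@[simp] lemma eval_mul : (p.mul q).eval t = p.eval t * q.eval t := by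
  induction p with
  | nil => simp [mul]
  | cons a p ih => simp only [mul, eval_add, eval_smul, eval_cons, ih]; push_cast; ring

variable {p}

lemma eval_eq_zero_of_isZero (h : p.isZero = true) : p.eval t = 0 := by
  induction p with
  | nil => rfl
  | cons a p ih =>
    simp only [isZero, List.all_cons, Bool.and_eq_true, beq_iff_eq] at h ih ⊢
    rw [eval_cons, h.1, ih h.2]
    simp

/-- A nonzero polynomial has finitely many roots. -/
lemma finite_roots (h : p.isZero = false) : {t : ℝ | p.eval t = 0}.Finite := by
  have key : ∀ q : IntPoly, ∃ P : Polynomial ℝ, (∀ t, P.eval t = q.eval t) ∧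
      (q.isZero = false → P ≠ 0) := by
    intro q
    induction q with
    | nil => exact ⟨0, by simp, by simp [isZero]⟩
    | cons a q ih =>
      obtain ⟨P, h1, h2⟩ := ih
      refine ⟨Polynomial.C (a : ℝ) + Polynomial.X * P, fun t => by simp [h1], fun h h0 => ?_⟩
      have hP : P = 0 := by
        ext k
        have := congrArg (fun R : Polynomial ℝ => R.coeff (k + 1)) h0
        simpa only [Polynomial.coeff_add, Polynomial.coeff_C_succ, Polynomial.coeff_X_mul, zero_add,
          Polynomial.coeff_zero] using this
      have ha : (a : ℝ) = 0 := by
        have := congrArg (fun R : Polynomial ℝ => R.coeff 0) h0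
        simpa using this
      have ha : a = 0 := by exact_mod_cast ha
      refine h2 ?_ hP
      simpa [isZero, ha] using h
  obtain ⟨P, h1, h2⟩ := key p
  refine (P.roots.toFinset.finite_toSet).subset fun t ht => ?_
  have ht : p.eval t = 0 := ht
  simp [h2 h, h1, ht]

end IntPoly

namespace Form

open LieCohomology

variable {n : ℕ} {L : Type*} [LieRing L] [LieAlgebra ℝ L] (b : Module.Basis (Fin n) ℝ L)

/-- The generator `e i` of the cochains, the `i`-th vector of the dual basis. -/
def gen (i : Fin n) : Cochains L := ExteriorAlgebra.ι ℝ (b.coord i)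

/-- The product of the generators in a word. -/
def wordVal (w : List (Fin n)) : Cochains L := (w.map (gen b)).prod

/-- The value of a form at the parameter `t`. -/
def eval (t : ℝ) (F : Form n) : Cochains L := (F.map fun a => a.1.eval t • wordVal b a.2).sum

@[simp] lemma wordVal_nil : wordVal b [] = 1 := rfl

@[simp] lemma wordVal_cons (i : Fin n) (w : List (Fin n)) :
    wordVal b (i :: w) = gen b i * wordVal b w := by simp [wordVal]

@[simp] lemma wordVal_append (v w : List (Fin n)) :
    wordVal b (v ++ w) = wordVal b v * wordVal b w := by simp [wordVal]

lemma gen_mul_gen (i j : Fin n) : gen b i * gen b j = -(gen b j * gen b i) :=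
  ι_anticomm L _ _

lemma gen_mul_self (i : Fin n) : gen b i * gen b i = 0 :=
  ExteriorAlgebra.ι_sq_zero _

lemma involute_gen (i : Fin n) : CliffordAlgebra.involute (gen b i) = -gen b i :=
  CliffordAlgebra.involute_ι _

lemma wordVal_mem (w : List (Fin n)) : wordVal b w ∈ ⋀[ℝ]^w.length (Module.Dual ℝ L) := by
  induction w with
  | nil => exact SetLike.GradedOne.one_mem
  | cons i w ih =>
    rw [wordVal_cons, List.length_cons, add_comm]
    refine SetLike.mul_mem_graded ?_ ih
    simp only [pow_one]
    exact ⟨_, rfl⟩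

variable (t : ℝ) (F G : Form n)

@[simp] lemma eval_nil : eval b t [] = 0 := rfl

@[simp] lemma eval_cons (a : IntPoly × List (Fin n)) :
    eval b t (a :: F) = a.1.eval t • wordVal b a.2 + eval b t F := by simp [eval]

@[simp] lemma eval_append : eval b t (F ++ G) = eval b t F + eval b t G := by simp [eval]

lemma eval_one : eval b t [([1], [])] = 1 := by simp

/-- The value of the form obtained by a map of terms that acts linearly on values. -/
lemma eval_map (g : IntPoly × List (Fin n) → IntPoly × List (Fin n))
    (φ : Cochains L →ₗ[ℝ] Cochains L)
    (h : ∀ a, (g a).1.eval t • wordVal b (g a).2 = φ (a.1.eval t • wordVal b a.2)) :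
    eval b t (F.map g) = φ (eval b t F) := by
  induction F with
  | nil => simp
  | cons a F ih => rw [List.map_cons, eval_cons, eval_cons, ih, map_add, h]

@[simp] lemma eval_mul : eval b t (F.mul G) = eval b t F * eval b t G := by
  induction F with
  | nil => simp [mul]
  | cons a F ih =>
    have : mul (a :: F) G = (G.map fun c => (a.1.mul c.1, a.2 ++ c.2)) ++ mul F G := rfl
    rw [this, eval_append, eval_cons, add_mul, ih]
    congr 1
    refine eval_map b t G _ (LinearMap.mulLeft ℝ (a.1.eval t • wordVal b a.2)) fun c => ?_
    simp [smul_smul, mul_comm]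

lemma eval_mem {m : ℕ} (h : ∀ a ∈ F, a.2.length = m) :
    eval b t F ∈ ⋀[ℝ]^m (Module.Dual ℝ L) := by
  induction F with
  | nil => exact Submodule.zero_mem _
  | cons a F ih =>
    rw [eval_cons]
    refine Submodule.add_mem _ (Submodule.smul_mem _ _ ?_)
      (ih fun c hc => h c (List.mem_cons_of_mem _ hc))
    rw [← h a List.mem_cons_self]
    exact wordVal_mem b a.2

section Differential

variable [Module.Finite ℝ L] {D : Fin n → Form n} {t}
lemma eval_dWord (hD : ∀ i, LieCohomology.d L (gen b i) = eval b t (D i))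
    (w : List (Fin n)) :
    eval b t (dWord D w) = LieCohomology.d L (wordVal b w) := by
  induction w with
  | nil =>
    rw [wordVal_nil, ← map_one (algebraMap ℝ (Cochains L)), d_algebraMap]
    rfl
  | cons i w ih =>
    rw [wordVal_cons, d_mul, involute_gen, dWord, eval_append, hD]
    congr 1
    · exact eval_map b t _ _ (LinearMap.mulRight ℝ (wordVal b w)) fun c => by simp
    · rw [← ih]
      exact eval_map b t _ _ (LinearMap.mulLeft ℝ (-gen b i)) fun c => by simp

lemma eval_d (hD : ∀ i, LieCohomology.d L (gen b i) = eval b t (D i)) :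
    eval b t (F.d D) = LieCohomology.d L (eval b t F) := by
  induction F with
  | nil => simp [Form.d]
  | cons a F ih =>
    have : Form.d D (a :: F) =
      ((dWord D a.2).map fun c => (a.1.mul c.1, c.2)) ++ Form.d D F := rfl
    rw [this, eval_append, eval_cons, map_add, ih, map_smul, ← eval_dWord b hD]
    congr 1
    exact eval_map b t _ _ (LinearMap.lsmul ℝ (Cochains L) (a.1.eval t)) fun c => by
      simp [smul_smul, mul_comm]

end Differential

/-! ### Sorting of words -/

lemma gen_mul_wordVal (i : Fin n) (w : List (Fin n)) :
    gen b i * wordVal b w = ((insertLetter i w).1 : ℝ) • wordVal b (insertLetter i w).2 := by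
  induction w with
  | nil => simp [insertLetter]
  | cons j w ih =>
    rw [insertLetter]
    split_ifs with h1 h2
    · simp
    · rw [h2, wordVal_cons, ← mul_assoc, gen_mul_self]
      simp
    · rw [wordVal_cons, ← mul_assoc, gen_mul_gen, neg_mul, mul_assoc, ih]
      simp

lemma wordVal_eq_sortWord (w : List (Fin n)) :
    wordVal b w = ((sortWord w).1 : ℝ) • wordVal b (sortWord w).2 := by
  induction w with
  | nil => simp [sortWord]
  | cons i w ih =>
    rw [wordVal_cons, ih, mul_smul_comm, gen_mul_wordVal, smul_smul, sortWord]
    push_cast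
    rfl

lemma mem_of_mem_insertLetter {i j : Fin n} {w : List (Fin n)} (h : j ∈ (insertLetter i w).2) :
    j = i ∨ j ∈ w := by
  induction w with
  | nil => simpa [insertLetter] using h
  | cons k w ih =>
    rw [insertLetter] at h
    split_ifs at h
    · simpa using h
    · simp at h
    · rcases List.mem_cons.1 h with h | h
      · exact Or.inr (h ▸ List.mem_cons_self)
      · exact (ih h).imp_right (List.mem_cons_of_mem _)

lemma pairwise_insertLetter (i : Fin n) {w : List (Fin n)} (hw : w.Pairwise (· < ·)) :
    (insertLetter i w).2.Pairwise (· < ·) := by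
  induction w with
  | nil => simp [insertLetter]
  | cons j w ih =>
    rw [insertLetter]
    rw [List.pairwise_cons] at hw
    split_ifs with h1 h2
    · refine List.pairwise_cons.2 ⟨fun k hk => ?_, List.pairwise_cons.2 hw⟩
      rcases List.mem_cons.1 hk with rfl | hk
      · exact h1
      · exact h1.trans (hw.1 k hk)
    · exact List.Pairwise.nil
    · refine List.pairwise_cons.2 ⟨fun k hk => ?_, ih hw.2⟩
      rcases mem_of_mem_insertLetter hk with rfl | hk
      · exact lt_of_le_of_ne (not_lt.1 h1) (Ne.symm h2)
      · exact hw.1 k hk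

lemma pairwise_sortWord (w : List (Fin n)) : (sortWord w).2.Pairwise (· < ·) := by
  induction w with
  | nil => exact List.Pairwise.nil
  | cons i w ih => exact pairwise_insertLetter i ih

lemma sublist_finRange {w : List (Fin n)} (hw : w.Pairwise (· < ·)) :
    w.Sublist (List.finRange n) := by
  refine List.sublist_of_subperm_of_pairwise (r := (· < ·)) ?_ hw (List.pairwise_lt_finRange n)
  exact List.Nodup.subperm (hw.imp ne_of_lt) fun i _ => List.mem_finRange i

lemma eval_addTerm (a : IntPoly × List (Fin n)) :
    eval b t (addTerm a F) = a.1.eval t • wordVal b a.2 + eval b t F := by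
  induction F with
  | nil => simp [addTerm]
  | cons c F ih =>
    rw [addTerm]
    split_ifs with h
    · simp [h, add_smul, add_assoc]
    · rw [eval_cons, eval_cons, ih, add_left_comm]

lemma eval_normalize : eval b t (normalize F) = eval b t F := by
  induction F with
  | nil => rfl
  | cons a F ih =>
    rw [normalize, eval_addTerm, ih, eval_cons, wordVal_eq_sortWord b a.2]
    simp [smul_smul, mul_comm]

lemma eval_eq_zero_of_isZero {F : Form n} (h : F.isZero = true) : eval b t F = 0 := by
  rw [← eval_normalize]
  rw [isZero, List.all_eq_true] at h
  refine List.sum_eq_zero fun x hx => ?_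
  obtain ⟨a, ha, rfl⟩ := List.mem_map.1 hx
  rw [IntPoly.eval_eq_zero_of_isZero t (h a ha), zero_smul]

/-- Words anticommute according to their lengths. -/
lemma wordVal_mul_comm (v w : List (Fin n)) :
    wordVal b v * wordVal b w = (-1 : ℝ) ^ (v.length * w.length) • (wordVal b w * wordVal b v) := by
  have h1 : ∀ i : Fin n, ∀ w : List (Fin n),
      gen b i * wordVal b w = (-1 : ℝ) ^ w.length • (wordVal b w * gen b i) := by
    intro i w
    induction w with
    | nil => simp
    | cons j w ih =>
      rw [wordVal_cons, ← mul_assoc, gen_mul_gen, neg_mul, mul_assoc, ih, List.length_cons,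
        pow_succ, mul_smul_comm, mul_assoc]
      module
  induction v with
  | nil => simp
  | cons i v ih =>
    rw [wordVal_cons, mul_assoc, ih, mul_smul_comm, ← mul_assoc, h1, smul_mul_assoc, smul_smul,
      List.length_cons, mul_assoc]
    congr 1
    ring

lemma eval_mul_comm {F G : Form n} {p q : ℕ} (hF : ∀ a ∈ F, a.2.length = p)
    (hG : ∀ a ∈ G, a.2.length = q) :
    eval b t F * eval b t G = (-1 : ℝ) ^ (p * q) • (eval b t G * eval b t F) := by
  have h1 : ∀ w : List (Fin n), w.length = p → ∀ G : Form n, (∀ a ∈ G, a.2.length = q) →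
      wordVal b w * eval b t G = (-1 : ℝ) ^ (p * q) • (eval b t G * wordVal b w) := by
    intro w hw G hG
    induction G with
    | nil => simp
    | cons a G ih =>
      rw [eval_cons, mul_add, ih fun c hc => hG c (List.mem_cons_of_mem _ hc), mul_smul_comm,
        wordVal_mul_comm, hw, hG a List.mem_cons_self, add_mul, smul_add, smul_mul_assoc,
        smul_comm]
  induction F with
  | nil => simp
  | cons a F ih =>
    rw [eval_cons, add_mul, ih fun c hc => hF c (List.mem_cons_of_mem _ hc), smul_mul_assoc,
      h1 a.2 (hF a List.mem_cons_self) G hG, mul_add, smul_add, mul_smul_comm, smul_comm]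

/-! ### The top coefficient -/

/-- The coefficient of `e 0 * ⋯ * e (n - 1)` in a cochain. -/
def trace : Cochains L →ₗ[ℝ] ℝ :=
  ExteriorAlgebra.liftAlternating (Pi.single n b.dualBasis.det)

lemma trace_eq_zero {k : ℕ} (hk : k ≠ n) {a : Cochains L} (ha : a ∈ ⋀[ℝ]^k (Module.Dual ℝ L)) :
    trace b a = 0 := by
  rw [← ExteriorAlgebra.ιMulti_span_fixedDegree] at ha
  induction ha using Submodule.span_induction with
  | mem x hx =>
    obtain ⟨v, rfl⟩ := hx
    rw [trace, ExteriorAlgebra.liftAlternating_apply_ιMulti, Pi.single_eq_of_ne hk]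
    rfl
  | zero => exact map_zero _
  | add x y _ _ hx hy => rw [map_add, hx, hy, add_zero]
  | smul c x _ hx => rw [map_smul, hx, smul_zero]

lemma trace_finRange : trace b (wordVal b (List.finRange n)) = 1 := by
  have : wordVal b (List.finRange n) = ExteriorAlgebra.ιMulti ℝ n b.dualBasis := by
    rw [ExteriorAlgebra.ιMulti_apply, wordVal, List.ofFn_eq_map, Module.Basis.coe_dualBasis]
    rfl
  rw [this, trace, ExteriorAlgebra.liftAlternating_apply_ιMulti, Pi.single_eq_same,
    Module.Basis.det_self]

lemma trace_wordVal_of_pairwise {w : List (Fin n)} (hw : w.Pairwise (· < ·)) :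
    trace b (wordVal b w) = if w.length = n then 1 else 0 := by
  split_ifs with h
  · rw [(sublist_finRange hw).eq_of_length (by rw [h, List.length_finRange]), trace_finRange]
  · exact trace_eq_zero b h (wordVal_mem b w)

lemma trace_eval : trace b (eval b t F) = F.top.eval t := by
  induction F with
  | nil => simp [top]
  | cons a F ih =>
    rw [eval_cons, map_add, ih, map_smul, top]
    split_ifs with h
    · rw [wordVal_eq_sortWord, map_smul, trace_wordVal_of_pairwise b (pairwise_sortWord _),
        if_pos h.2]
      simp [mul_comm]
    · have : trace b (wordVal b a.2) = 0 := by
        by_cases h1 : a.2.length = n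
        · rw [wordVal_eq_sortWord, map_smul, trace_wordVal_of_pairwise b (pairwise_sortWord _),
            if_neg fun h2 => h ⟨h1, h2⟩, smul_zero]
        · exact trace_eq_zero b h1 (wordVal_mem b _)
      rw [this, smul_zero, zero_add]

/-- The vectors of the basis of the cochains that comes from the dual basis are increasing words. -/
lemma basis_exteriorAlgebra_apply (s : Finset (Fin n)) :
    ∃ w ∈ (List.finRange n).sublists, b.dualBasis.ExteriorAlgebra s = wordVal b w := by
  rw [ExteriorAlgebra.basis_apply]
  refine ⟨List.ofFn (Set.powersetCard.ofFinEmbEquiv.symm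
    (Set.powersetCard.prodEquiv.symm s).2), ?_, ?_⟩
  · rw [List.mem_sublists]
    refine sublist_finRange ?_
    rw [List.pairwise_ofFn]
    exact fun i j hij => (OrderEmbedding.strictMono _) hij
  · refine (ExteriorAlgebra.ιMulti_apply _).trans ?_
    rw [wordVal, List.map_ofFn, Module.Basis.coe_dualBasis]
    rfl

lemma finrank_cochains (b : Module.Basis (Fin n) ℝ L) : Module.finrank ℝ (Cochains L) = 2 ^ n := by
  rw [Module.finrank_eq_card_basis b.dualBasis.ExteriorAlgebra]
  simp

lemma finiteDimensional_cochains (b : Module.Basis (Fin n) ℝ L) :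
    FiniteDimensional ℝ (Cochains L) :=
  Module.Finite.of_basis b.dualBasis.ExteriorAlgebra

end Form

/-! ### Certificates -/

/-- Data that determine the cohomology of a one-parameter family of `n`-dimensional Lie algebras up
to isomorphism, for all but finitely many parameters, if `Certificate.Valid` holds. -/
structure Certificate (n : ℕ) where
  /-- The brackets: an entry `(c, i, j)` of `B k` stands for the summand `c` of the coefficient of
  the `k`-th basis vector in the bracket of the `i`-th and the `j`-th. -/
  B : Fin n → List (IntPoly × Fin n × Fin n)
  /-- The common factor of the top coefficients of all triple products of cocycles. -/
  E : IntPoly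
  /-- Cocycles that represent a basis of the cohomology in positive degrees. -/
  z : List (Form n)
  /-- Forms `v` whose differentials are linearly independent, each with a word `u`: the top
  coefficients of the products of a differential and a word make up a triangular matrix. -/
  w : List (Form n × List (Fin n))

namespace Certificate

variable {n : ℕ} (C : Certificate n)

/-- The differentials of the generators. -/
def D (k : Fin n) : Form n := (C.B k).map fun a => (a.1.smul (-1), [a.2.1, a.2.2])

/-- The value at `x`, `y` of the bilinear form on `ℝⁿ` given by `B k` at the parameter `t`. -/
def bracketCoord (t : ℝ) (k : Fin n) (x y : Fin n → ℝ) : ℝ :=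
  ((C.B k).map fun a => a.1.eval t * (x a.2.1 * y a.2.2 - x a.2.2 * y a.2.1)).sum

/-- The cocycles of a certificate, including the unit. -/
def forms : List (Form n) := [([1], [])] :: C.z

/-- Whether the top coefficient of a form is an integer multiple of `E`. -/
def proportional (F : Form n) : Bool := (F.top.add (C.E.smul (-F.top.ratio C.E))).isZero

/-- An entry of the matrix that proves the differentials of the forms in `w` independent. -/
def pivot (a b : Form n × List (Fin n)) : IntPoly :=
  ((a.1.d C.D).mul [([1], b.2)]).top

/-- Whether the top coefficients of the coboundaries vanish. -/
def checkTrace : Bool :=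
  (List.finRange n).sublists.all fun w => (Form.dWord C.D w).top.isZero

/-- Whether the cocycles are homogeneous and closed. -/
def checkCocycles : Bool := C.forms.all fun z => z.isHomogeneous && (z.d C.D).isZero

/-- Whether the products `x * y * z` of top degree, `z` in `l`, are proportional to `E`. -/
def checkRow (x y : Form n) (l : List (Form n)) : Bool :=
  l.all fun z => x.deg + y.deg + z.deg != n || C.proportional (x.mul (y.mul z))

/-- `checkRow` for all `y`, `z` in a list with `z` not before `y`. -/
def checkPairs (x : Form n) : List (Form n) → Bool
  | [] => true
  | y :: l => C.checkRow x y (y :: l) && checkPairs x l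

/-- `checkRow` for all `x`, `y`, `z` in a list in this order, with repetitions allowed. -/
def checkTriples : List (Form n) → Bool
  | [] => true
  | x :: l => C.checkPairs x (x :: l) && checkTriples l

/-- Whether each cocycle has a partner such that the partner has a nonzero pairing with it and
pairs to zero with all others. -/
def checkDual : Bool :=
  (List.finRange C.forms.length).all fun i => (List.finRange C.forms.length).any fun j =>
    C.proportional (C.forms[i].mul C.forms[j]) &&
    (C.forms[i].mul C.forms[j]).top.ratio C.E != 0 &&
    (List.finRange C.forms.length).all fun k =>
      k == i || (C.forms[k].mul C.forms[j]).top.isZero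

/-- Whether the matrix of all `pivot a b` is triangular with nonzero polynomials on the
diagonal. -/
def checkTriangular : List (Form n × List (Fin n)) → Bool
  | [] => true
  | a :: l => !(C.pivot a a).isZero && l.all (fun b => (C.pivot b a).isZero) && checkTriangular l

/-- All conditions on a certificate. The last one makes the cocycles span the cohomology. -/
structure Valid : Prop where
  trace : C.checkTrace = true
  cocycles : C.checkCocycles = true
  triples : C.checkTriples C.forms = true
  dual : C.checkDual = true
  triangular : C.checkTriangular C.w = true
  E_ne_zero : C.E.isZero = false
  card : C.forms.length + 2 * C.w.length = 2 ^ n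

/-- The parameters where `E` or a diagonal entry of the triangular matrix vanishes. -/
def exceptional : Set ℝ :=
  {t | C.E.eval t = 0} ∪ ⋃ a ∈ {a | a ∈ C.w}, {t | (C.pivot a a).eval t = 0}

variable {C}

lemma eval_top_of_proportional {F : Form n} (h : C.proportional F = true) (t : ℝ) :
    F.top.eval t = (F.top.ratio C.E : ℝ) * C.E.eval t := by
  have := IntPoly.eval_eq_zero_of_isZero t h
  simp only [IntPoly.eval_add, IntPoly.eval_smul, Int.cast_neg] at this
  linarith

lemma checkTriangular_spec {l : List (Form n × List (Fin n))} (h : C.checkTriangular l = true) :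
    (∀ a ∈ l, (C.pivot a a).isZero = false) ∧
      l.Pairwise fun a b => (C.pivot b a).isZero = true := by
  induction l with
  | nil => simp
  | cons a l ih =>
    simp only [checkTriangular, Bool.and_eq_true, Bool.not_eq_true', List.all_eq_true] at h
    obtain ⟨h1, h2⟩ := ih h.2
    exact ⟨List.forall_mem_cons.2 ⟨h.1.1, h1⟩, List.pairwise_cons.2 ⟨h.1.2, h2⟩⟩

lemma Valid.finite_exceptional (hC : C.Valid) : C.exceptional.Finite := by
  refine (IntPoly.finite_roots hC.E_ne_zero).union ?_
  refine Set.Finite.biUnion (List.finite_toSet C.w) fun a ha => ?_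
  exact IntPoly.finite_roots ((checkTriangular_spec hC.triangular).1 a ha)

lemma Valid.length_eq_deg (hC : C.Valid) {x : Form n} (hx : x ∈ C.forms) :
    ∀ a ∈ x, a.2.length = x.deg := by
  have h := hC.cocycles
  rw [checkCocycles, List.all_eq_true] at h
  have h1 := (Bool.and_eq_true _ _ ▸ h x hx :).1
  rw [Form.isHomogeneous, List.all_eq_true] at h1
  exact fun a ha => by simpa using h1 a ha

section Family

open LieCohomology

variable {L : ℝ → Type*} [∀ t, LieRing (L t)] [∀ t, LieAlgebra ℝ (L t)]
  (b : ∀ t, Module.Basis (Fin n) ℝ (L t))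

/-- The top coefficient of `x * y * z` is a constant multiple of `E`. -/
def HasConstantTrace (C : Certificate n) (b : ∀ t, Module.Basis (Fin n) ℝ (L t))
    (x y z : Form n) : Prop :=
  ∃ c : ℝ, ∀ t, Form.trace (b t) (x.eval (b t) t * y.eval (b t) t * z.eval (b t) t) =
    c * C.E.eval t

lemma hasConstantTrace_of_checkRow {x y z : Form n} {l : List (Form n)}
    (hx : ∀ a ∈ x, a.2.length = x.deg) (hy : ∀ a ∈ y, a.2.length = y.deg)
    (hz : ∀ a ∈ z, a.2.length = z.deg) (hl : z ∈ l) (h : C.checkRow x y l = true) :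
    C.HasConstantTrace b x y z := by
  rw [checkRow, List.all_eq_true] at h
  by_cases hdeg : x.deg + y.deg + z.deg = n
  · have hp : C.proportional (x.mul (y.mul z)) = true := by simpa [hdeg] using h z hl
    refine ⟨((x.mul (y.mul z)).top.ratio C.E : ℤ), fun t => ?_⟩
    rw [← eval_top_of_proportional hp, ← Form.trace_eval (b t)]
    simp [mul_assoc]
  · refine ⟨0, fun t => ?_⟩
    rw [zero_mul]
    exact Form.trace_eq_zero _ hdeg (SetLike.mul_mem_graded (SetLike.mul_mem_graded
      (Form.eval_mem _ t x hx) (Form.eval_mem _ t y hy)) (Form.eval_mem _ t z hz))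

lemma HasConstantTrace.swap_left {x y z : Form n} (hx : ∀ a ∈ x, a.2.length = x.deg)
    (hy : ∀ a ∈ y, a.2.length = y.deg) (h : C.HasConstantTrace b x y z) :
    C.HasConstantTrace b y x z := by
  obtain ⟨c, hc⟩ := h
  refine ⟨(-1) ^ (y.deg * x.deg) * c, fun t => ?_⟩
  rw [Form.eval_mul_comm (b t) t hy hx, smul_mul_assoc, map_smul, hc, smul_eq_mul, mul_assoc]

lemma HasConstantTrace.swap_right {x y z : Form n} (hy : ∀ a ∈ y, a.2.length = y.deg)
    (hz : ∀ a ∈ z, a.2.length = z.deg) (h : C.HasConstantTrace b x y z) :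
    C.HasConstantTrace b x z y := by
  obtain ⟨c, hc⟩ := h
  refine ⟨(-1) ^ (z.deg * y.deg) * c, fun t => ?_⟩
  rw [mul_assoc, Form.eval_mul_comm (b t) t hz hy, mul_smul_comm, map_smul, ← mul_assoc, hc,
    smul_eq_mul, mul_assoc]

lemma hasConstantTrace_of_checkPairs {x : Form n} (hx : ∀ a ∈ x, a.2.length = x.deg)
    {l : List (Form n)} (hl : ∀ y ∈ l, ∀ a ∈ y, a.2.length = y.deg)
    (h : C.checkPairs x l = true) : ∀ y ∈ l, ∀ z ∈ l, C.HasConstantTrace b x y z := by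
  induction l with
  | nil => simp
  | cons u l ih =>
    simp only [checkPairs, Bool.and_eq_true] at h
    have ih := ih (fun y hy => hl y (List.mem_cons_of_mem _ hy)) h.2
    have hu : ∀ z ∈ u :: l, C.HasConstantTrace b x u z := fun z hz =>
      hasConstantTrace_of_checkRow b hx (hl u List.mem_cons_self) (hl z hz) hz h.1
    intro y hy z hz
    rcases List.mem_cons.1 hy with rfl | hy'
    · exact hu z hz
    rcases List.mem_cons.1 hz with rfl | hz'
    · exact (hu y hy).swap_right b (hl z hz) (hl y hy)
    · exact ih y hy' z hz'

lemma hasConstantTrace_of_checkTriples {l : List (Form n)}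
    (hl : ∀ y ∈ l, ∀ a ∈ y, a.2.length = y.deg) (h : C.checkTriples l = true) :
    ∀ x ∈ l, ∀ y ∈ l, ∀ z ∈ l, C.HasConstantTrace b x y z := by
  induction l with
  | nil => simp
  | cons u l ih =>
    simp only [checkTriples, Bool.and_eq_true] at h
    have ih := ih (fun y hy => hl y (List.mem_cons_of_mem _ hy)) h.2
    have hu : ∀ y ∈ u :: l, ∀ z ∈ u :: l, C.HasConstantTrace b u y z :=
      hasConstantTrace_of_checkPairs b (hl u List.mem_cons_self) hl h.1
    intro x hx y hy z hz
    rcases List.mem_cons.1 hx with rfl | hx'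
    · exact hu y hy z hz
    rcases List.mem_cons.1 hy with rfl | hy'
    · exact (hu x hx z hz).swap_left b (hl y hy) (hl x hx)
    rcases List.mem_cons.1 hz with rfl | hz'
    · exact ((hu x hx y hy).swap_left b (hl z hz) (hl x hx)).swap_right b (hl z hz) (hl y hy)
    · exact ih x hx' y hy' z hz'

end Family

section Single

open LieCohomology

variable {L : Type*} [LieRing L] [LieAlgebra ℝ L] [Module.Finite ℝ L]
  (b : Module.Basis (Fin n) ℝ L) {t : ℝ}

/-- The differential of a generator, read off from the brackets. -/
lemma d_gen_of_bracketCoord (k : Fin n)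
    (h : ∀ i j, b.coord k ⁅b i, b j⁆ = C.bracketCoord t k (Pi.single i 1) (Pi.single j 1)) :
    LieCohomology.d L (Form.gen b k) = Form.eval b t (C.D k) := by
  have hd : LieCohomology.d L (Form.gen b k) = (-(1 / 2) : ℝ) • ∑ i, ∑ j,
      b.coord k ⁅b i, b j⁆ • (Form.gen b i * Form.gen b j) := by
    rw [Form.gen, d_ι, dDual_eq_sum L b]
    rfl
  simp only [hd, h, bracketCoord, D]
  induction C.B k with
  | nil => simp
  | cons a l ih =>
    simp only [List.map_cons, List.sum_cons, Form.eval_cons, ← ih, add_smul,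
      Finset.sum_add_distrib, smul_add]
    congr 1
    simp only [Pi.single_apply, mul_sub, sub_smul, Finset.sum_sub_distrib, mul_ite, mul_one,
      mul_zero, ite_smul, zero_smul, Finset.sum_ite_eq, Finset.mem_univ, if_true,
      IntPoly.eval_smul, Form.wordVal_cons, Form.wordVal_nil]
    rw [Form.gen_mul_gen b a.2.2 a.2.1]
    push_cast
    module

/-- The trace vanishes on coboundaries: it suffices to check the increasing words. -/
lemma Valid.trace_d (hC : C.Valid)
    (hD : ∀ i, LieCohomology.d L (Form.gen b i) = Form.eval b t (C.D i)) (a : Cochains L) :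
    Form.trace b (LieCohomology.d L a) = 0 := by
  suffices h : Form.trace b ∘ₗ LieCohomology.d L = 0 from congrArg (fun f => f a) h
  refine b.dualBasis.ExteriorAlgebra.ext fun s => ?_
  obtain ⟨w, hw, hs⟩ := Form.basis_exteriorAlgebra_apply b s
  have h := hC.trace
  rw [checkTrace, List.all_eq_true] at h
  rw [hs, LinearMap.comp_apply, ← Form.eval_dWord b hD, Form.trace_eval,
    IntPoly.eval_eq_zero_of_isZero t (h w hw)]
  rfl

lemma eval_pivot (hD : ∀ i, LieCohomology.d L (Form.gen b i) = Form.eval b t (C.D i))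
    (a c : Form n × List (Fin n)) :
    (C.pivot a c).eval t =
      Form.trace b (LieCohomology.d L (a.1.eval b t) * Form.wordVal b c.2) := by
  rw [pivot, ← Form.trace_eval b, Form.eval_mul, Form.eval_d b _ hD]
  simp

/-- Away from the exceptional parameters the differentials of the forms in `w` are linearly
independent, because the triangular matrix is invertible. -/
lemma Valid.linearIndependent_d (hC : C.Valid)
    (hD : ∀ i, LieCohomology.d L (Form.gen b i) = Form.eval b t (C.D i))
    (ht : t ∉ C.exceptional) :
    LinearIndependent ℝ fun k : Fin C.w.length =>
      LieCohomology.d L (C.w[k].1.eval b t) := by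
  obtain ⟨-, h2⟩ := checkTriangular_spec hC.triangular
  let A : Matrix (Fin C.w.length) (Fin C.w.length) ℝ := fun k i => (C.pivot C.w[k] C.w[i]).eval t
  have hA : A.det ≠ 0 := by
    rw [Matrix.det_of_isUpperTriangular]
    · refine Finset.prod_ne_zero_iff.2 fun i _ h0 => ht (Or.inr ?_)
      exact Set.mem_biUnion (List.getElem_mem i.2) h0
    · intro k i hik
      exact IntPoly.eval_eq_zero_of_isZero t (List.pairwise_iff_getElem.1 h2 i k i.2 k.2 hik)
  let φ : Cochains L →ₗ[ℝ] (Fin C.w.length → ℝ) := LinearMap.pi fun i =>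
    Form.trace b ∘ₗ LinearMap.mulRight ℝ (Form.wordVal b C.w[i].2)
  refine LinearIndependent.of_comp φ ?_
  have hrow : (φ ∘ fun k : Fin C.w.length => LieCohomology.d L (C.w[k].1.eval b t)) = A.row := by
    funext k i
    exact (eval_pivot b hD C.w[k] C.w[i]).symm
  rw [hrow]
  exact Matrix.linearIndependent_rows_of_det_ne_zero hA

/-- The frame of cocycles given by a certificate; its trace form is the top coefficient divided by
`E`, which makes the traces of triple products independent of the parameter. -/
def Valid.frame (hC : C.Valid)
    (hD : ∀ i, LieCohomology.d L (Form.gen b i) = Form.eval b t (C.D i))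
    (ht : t ∉ C.exceptional) :
    DualityFrame L n (fun i : Fin C.forms.length => C.forms[i].deg) ⟨0, Nat.succ_pos _⟩ where
  ε := (C.E.eval t)⁻¹ • Form.trace b
  ε_d a := by rw [LinearMap.smul_apply, hC.trace_d b hD, smul_zero]
  ε_deg k hk a ha := by rw [LinearMap.smul_apply, Form.trace_eq_zero b hk ha, smul_zero]
  z i := C.forms[i].eval b t
  d_z i := by
    have h := hC.cocycles
    rw [checkCocycles, List.all_eq_true] at h
    have h1 := h C.forms[i] (List.getElem_mem _)
    rw [Bool.and_eq_true] at h1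
    rw [← Form.eval_d b _ hD]
    exact Form.eval_eq_zero_of_isZero b t h1.2
  z_mem i := Form.eval_mem b t _ (hC.length_eq_deg (List.getElem_mem _))
  z_one := Form.eval_one b t
  dual i := by
    have hE : C.E.eval t ≠ 0 := fun h => ht (Or.inl h)
    have h := hC.dual
    simp only [checkDual, List.all_eq_true, List.any_eq_true, Bool.and_eq_true, List.mem_finRange,
      true_and, forall_true_left, bne_iff_ne, Bool.or_eq_true, beq_iff_eq] at h
    obtain ⟨j, ⟨h1, h2⟩, h3⟩ := h i
    refine ⟨j, ?_, fun k hk => ?_⟩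
    · rw [LinearMap.smul_apply, ← Form.eval_mul, Form.trace_eval, eval_top_of_proportional h1]
      exact smul_ne_zero (inv_ne_zero hE) (mul_ne_zero (Int.cast_ne_zero.2 h2) hE)
    · rw [LinearMap.smul_apply, ← Form.eval_mul, Form.trace_eval,
        IntPoly.eval_eq_zero_of_isZero t ((h3 k).resolve_left hk), smul_zero]
  finrank_le := by
    have := Form.finiteDimensional_cochains b
    have h := finrank_cohomology_add_le _ (hC.linearIndependent_d b hD ht)
    rw [Form.finrank_cochains b, ← hC.card] at h
    rw [Fintype.card_fin]
    omega

end Single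

/-- A valid certificate proves that all members of the family outside the exceptional set have
isomorphic cohomology algebras. -/
theorem Valid.isomorphicCohomology (hC : C.Valid) {L : ℝ → Type*} [∀ t, LieRing (L t)]
    [∀ t, LieAlgebra ℝ (L t)] [∀ t, Module.Finite ℝ (L t)]
    (b : ∀ t, Module.Basis (Fin n) ℝ (L t))
    (hD : ∀ t i, LieCohomology.d (L t) (Form.gen (b t) i) = Form.eval (b t) t (C.D i))
    {s t : ℝ} (hs : s ∉ C.exceptional) (ht : t ∉ C.exceptional) :
    LieCohomology.IsomorphicCohomology (L s) (L t) := by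
  have := Form.finiteDimensional_cochains (b s)
  have := Form.finiteDimensional_cochains (b t)
  refine (hC.frame (b s) (hD s) hs).isomorphicCohomology (hC.frame (b t) (hD t) ht) fun i j k => ?_
  obtain ⟨c, hc⟩ := hasConstantTrace_of_checkTriples b (fun y hy => hC.length_eq_deg hy) hC.triples
    C.forms[i] (List.getElem_mem _) C.forms[j] (List.getElem_mem _) C.forms[k] (List.getElem_mem _)
  have key : ∀ r : ℝ, r ∉ C.exceptional → (C.E.eval r)⁻¹ * Form.trace (b r)
      (C.forms[i].eval (b r) r * C.forms[j].eval (b r) r * C.forms[k].eval (b r) r) = c := by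
    intro r hr
    have hE : C.E.eval r ≠ 0 := fun h => hr (Or.inl h)
    rw [hc r, mul_comm c, inv_mul_cancel_left₀ hE]
  exact (key s hs).trans (key t ht).symm

end Certificate

/-! ### The five families -/

namespace Certificate

/-- The word with the decimal digits of a number, of which there are at most `f`, as letters; the
digit `i` stands for the `i`-th generator, which has index `i - 1`. -/
def wordOfDigits : ℕ → ℕ → List (Fin 7)
  | 0, _ => []
  | f + 1, m => if m = 0 then [] else wordOfDigits f (m / 10) ++ [Fin.ofNat 7 (m % 10 - 1)]

/-- A form whose words are given by decimal digits. -/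
def formOfDigits (l : List (IntPoly × ℕ)) : Form 7 := l.map fun a => (a.1, wordOfDigits 7 a.2)

/-- A certificate whose words are given by decimal digits. -/
def ofDigits (B : Fin 7 → List (IntPoly × Fin 7 × Fin 7)) (E : IntPoly)
    (z : List (List (IntPoly × ℕ))) (w : List (List (IntPoly × ℕ) × ℕ)) : Certificate 7 where
  B := B
  E := E
  z := z.map formOfDigits
  w := w.map fun a => (formOfDigits a.1, wordOfDigits 7 a.2)

/-- The certificate for `123457I`. With the classes `p` of `156 + 246 - 2 * 345` and `q` of
`237 - 246 + 345` in degree 3, the square of the degree 2 class of `17 + ⋯` would be the only product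
that depends on `t`. They are replaced by `(3t-2)p + (5t-3)q`, which is orthogonal to the
square, and `3p + 5q`, whose pairing with it is `-2`. The basis in degree 4 is dual to this one
up to signs. -/
def f123457I : Certificate 7 :=
  ofDigits
    ![[], [], [([1], 0, 1)], [([1], 0, 2)], [([1], 0, 3), ([1], 1, 2)],
      [([1], 0, 4), ([1], 1, 3)], [([1], 0, 5), ([0,1], 1, 4), ([1,-1], 2, 3)]]
    [1]
    [[([1], 1)], [([1], 2)], [([1], 23)], [([1], 25), ([-1], 34)],
      [([1], 17), ([1,-1], 35), ([-1,2], 26)], [([1], 145), ([-1], 235)],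
      [([1], 236), ([-1], 245)], [([-2,3], 156), ([1,-2], 246), ([1,-1], 345), ([-3,5], 237)],
      [([3], 156), ([-2], 246), ([-1], 345), ([5], 237)],
      [([-3,5], 2347), ([1,-2], 2356), ([2,-3], 1456)], [([5], 2347), ([-2], 2356), ([-3], 1456)],
      [([1], 1457), ([-1], 2357), ([1], 2456)], [([1], 2367), ([-1], 2457), ([1], 3456)],
      [([1], 23456)], [([1], 13467), ([0,-1], 23457)], [([1], 14567), ([-1], 23567)],
      [([1], 134567)], [([1], 234567)], [([1], 1234567)]]
    [([([1], 7)], 23457), ([([1], 4)], 24567), ([([1], 6)], 23467), ([([1], 5)], 14567),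
      ([([1], 3)], 34567), ([([1], 47)], 2456), ([([1], 56)], 1367), ([([1], 57)], 1267),
      ([([1], 37)], 3456), ([([1], 67)], 1356), ([([1], 46)], 2457), ([([1], 36)], 3457),
      ([([1], 45)], 2467), ([([1], 27), ([-1], 36), ([1], 45)], 1567), ([([1], 17)], 2567),
      ([([1], 26)], 3467), ([([1], 15)], 4567), ([([1], 16)], 3567), ([([1], 567)], 136),
      ([([1], 357)], 256), ([([1], 467)], 245), ([([1], 456)], 247), ([([1], 457)], 237),
      ([([1], 267)], 346), ([([1], 367)], 345), ([([1], 347)], 257), ([([1], 257)], 356),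
      ([([1], 356), ([-1], 347), ([1], 257)], 347),
      ([([1], 167), ([0,1], 347), ([1,-1], 257), ([-1], 356)], 167), ([([1], 247)], 456),
      ([([1], 156)], 457), ([([1], 127)], 567), ([([1], 147)], 367), ([([1], 346)], 267),
      ([([1], 256)], 357), ([([1], 137)], 467), ([([1], 3567)], 25), ([([1], 3467)], 26),
      ([([1], 2567)], 35), ([([1], 4567)], 15), ([([1], 1567)], 45), ([([1], 3457)], 36),
      ([([1], 2467), ([1], 1567), ([-2], 3457)], 27), ([([1], 2367)], 46), ([([1], 1367)], 56),
      ([([1], 2346)], 67), ([([1], 2347)], 57), ([([1], 2456)], 47), ([([1], 1467)], 37),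
      ([([1], 24567)], 4), ([([1], 34567)], 3), ([([1], 13467)], 7), ([([1], 14567)], 5),
      ([([1], 13567)], 6)]

lemma valid_f123457I : f123457I.Valid where
  trace := by decide +kernel
  cocycles := by decide +kernel
  triples := by decide +kernel
  dual := by decide +kernel
  triangular := by decide +kernel
  E_ne_zero := by decide +kernel
  card := by decide +kernel

/-- The certificate for `12457N`. The triple products of these cocycles do not depend on `t`,
although the cocycles do. -/
def f12457N : Certificate 7 :=
  ofDigits
    ![[], [], [([1], 0, 1)], [([1], 0, 2)], [([1], 1, 2)], [([1], 0, 4), ([1], 1, 3)],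
      [([1], 0, 3), ([1], 0, 5), ([0,1], 1, 4), ([1], 1, 5), ([1], 2, 3), ([-1], 2, 4)]]
    [1]
    [[([1], 1)], [([1], 2)], [([1], 14)], [([1], 25)], [([1], 16), ([1], 34)], [([1], 134)],
      [([1], 146)], [([1], 156), ([1], 246), ([-2], 345)], [([1], 256)],
      [([1], 1347), ([1], 1456), ([0,1], 2346)], [([1], 2347), ([-1], 1456)],
      [([1], 2357), ([-1], 2456), ([1], 2346)],
      [([3], 2567), ([-1], 1567), ([-1], 2467), ([2], 3457), ([3], 1467), ([-3,-3], 3456)],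
      [([1], 23457), ([1], 13457)], [([1], 13467), ([0,1], 13457)], [([1], 23567), ([1], 13457)],
      [([1], 134567)], [([1], 234567)], [([1], 1234567)]]
    [([([1], 7)], 13457), ([([1], 6)], 13567), ([([1], 3)], 34567), ([([1], 4)], 24567),
      ([([1], 5)], 14567), ([([1], 67)], 1247), ([([1], 57)], 1456), ([([1], 46)], 2367),
      ([([1], 47)], 2357), ([([1], 56)], 1367), ([([1], 37)], 1457), ([([1], 27)], 1467),
      ([([1], 17)], 2567), ([([1], 36)], 3457), ([([1], 45)], 2467), ([([1], 35)], 3467),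
      ([([1], 15)], 4567), ([([1], 16)], 3567), ([([1], 367)], 345), ([([1], 567)], 136),
      ([([1], 467)], 236), ([([1], 457)], 246), ([([1], 167)], 356), ([([1], 247)], 456),
      ([([1], 357)], 147), ([([1], 346)], 267), ([([1], 356)], 167), ([([1], 456)], 247),
      ([([1], 257), ([1], 356)], 347), ([([1], 147), ([-1], 346)], 357),
      ([([1], 267), ([1], 357), ([1], 346), ([-1], 456)], 157),
      ([([1], 347), ([1], 167), ([1], 456), ([0,-1], 257)], 257), ([([1], 136)], 567),
      ([([1], 246)], 457), ([([1], 345)], 367), ([([1], 245)], 467), ([([1], 3467)], 35),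
      ([([1], 4567)], 24), ([([1], 3567)], 16), ([([1], 2467)], 45), ([([1], 3457)], 36),
      ([([1], 2567)], 17), ([([1], 1467)], 27), ([([1], 1367)], 56), ([([1], 2457)], 37),
      ([([1], 2367)], 46), ([([1], 2456)], 47), ([([1], 1456)], 57), ([([1], 1257)], 67),
      ([([1], 14567)], 5), ([([1], 24567)], 4), ([([1], 12567)], 7), ([([1], 23467)], 6),
      ([([1], 34567)], 3)]

lemma valid_f12457N : f12457N.Valid where
  trace := by decide +kernel
  cocycles := by decide +kernel
  triples := by decide +kernel
  dual := by decide +kernel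
  triangular := by decide +kernel
  E_ne_zero := by decide +kernel
  card := by decide +kernel

/-- The certificate for `12457N₂`. The triple products of these cocycles do not depend on `t`,
although the cocycles do. -/
def f12457N₂ : Certificate 7 :=
  ofDigits
    ![[], [], [([1], 0, 1)], [([1], 0, 2)], [([1], 1, 2)], [([-1], 0, 3), ([-1], 1, 4)],
      [([1], 0, 4), ([1], 0, 5), ([1], 1, 3), ([0,1], 1, 4), ([-1], 2, 4)]]
    [1]
    [[([1], 1)], [([1], 2)], [([1], 14)], [([1], 15), ([1], 24)], [([1], 26), ([1], 34)],
      [([1], 134)], [([1], 146), ([-1], 345)], [([1], 156), ([1], 246)],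
      [([1], 256), ([-1], 345)], [([1], 1347), ([0,1], 1346)],
      [([1], 2347), ([-1], 1456), ([-1], 1346)], [([1], 2357), ([-1], 2456)],
      [([2], 2567), ([-1], 3457), ([-1], 1467), ([0,1], 3456)], [([1], 13457)],
      [([1], 23467), ([1], 23457)], [([1], 23567), ([-1], 13467), ([0,1], 23457)],
      [([1], 134567)], [([1], 234567)], [([1], 1234567)]]
    [([([1], 7)], 12467), ([([1], 3)], 34567), ([([1], 6)], 13467), ([([1], 5)], 14567),
      ([([1], 4)], 24567), ([([1], 36)], 2567), ([([1], 47)], 1267), ([([1], 67)], 2356),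
      ([([1], 37)], 3456), ([([1], 56)], 2367), ([([1], 46)], 2457), ([([1], 27)], 1467),
      ([([1], 57)], 1367), ([([1], 45)], 1567), ([([1], 17)], 2467), ([([1], 26)], 3567),
      ([([1], 35)], 3467), ([([1], 24)], 4567), ([([1], 457)], 246), ([([1], 567)], 236),
      ([([1], 367)], 256), ([([1], 467)], 127), ([([1], 267)], 147), ([([1], 347)], 257),
      ([([1], 456)], 157), ([([1], 357)], 247), ([([1], 346)], 167),
      ([([1], 247), ([1], 346)], 357), ([([1], 167), ([1], 357), ([-1], 346)], 346),
      ([([1], 157)], 456), ([([1], 146)], 367), ([([1], 356)], 267), ([([1], 156)], 457),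
      ([([1], 257)], 347), ([([1], 236)], 567), ([([1], 245)], 467), ([([1], 3467)], 35),
      ([([1], 4567)], 15), ([([1], 3567)], 34), ([([1], 3457)], 27), ([([1], 2457)], 46),
      ([([1], 2567)], 36), ([([1], 2467)], 17), ([([1], 2367)], 56), ([([1], 1567)], 45),
      ([([1], 3456)], 37), ([([1], 1456)], 57), ([([1], 1267)], 47), ([([1], 1347)], 67),
      ([([1], 14567)], 5), ([([1], 34567)], 3), ([([1], 23567)], 6), ([([1], 24567)], 4),
      ([([1], 13567)], 7)]

lemma valid_f12457N₂ : f12457N₂.Valid where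
  trace := by decide +kernel
  cocycles := by decide +kernel
  triples := by decide +kernel
  dual := by decide +kernel
  triangular := by decide +kernel
  E_ne_zero := by decide +kernel
  card := by decide +kernel

/-- The certificate for `1357M`. Let `x` be the degree 2 class of `17 + ⋯` and `y` that of the
one-form `2`. The products `x * y` and `x * x` span lines in degrees 3 and 4 that move with `t`.
Therefore the basis in degree 3 contains a multiple of `x * y` and a vector orthogonal to
`x * x`. All other dependence on `t` is removed by rescaling the cocycles; up to constants, the
scales of dual classes have the product `E = t³ (1 - 2t) (3t - 2)`. -/
def f1357M : Certificate 7 :=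
  ofDigits
    ![[], [], [([1], 0, 1)], [], [([1], 0, 2), ([1], 1, 3)], [([1], 0, 3)],
      [([1], 0, 4), ([0,1], 1, 5), ([1,-1], 2, 3)]]
    [0,0,0,-2,7,-6]
    [[([-2,3], 1)], [([0,0,-2,3], 2)], [([1], 4)], [([0,0,-2,3], 13)], [([0,0,0,1,-2], 23)],
      [([0,-2,3], 15), ([0,-2,3], 34)], [([-2,3], 16)], [([1], 46)],
      [([1], 17), ([0,1], 36), ([-1,2], 45)], [([0,0,0,-2,7,-6], 235)], [([0,-2,3], 145)],
      [([0,0,2,-7,6], 245), ([0,0,-2,3], 135), ([0,0,0,-4,6], 236)],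
      [([1,-2], 245), ([-1,3], 135), ([0,1], 236)], [([-2,3], 146)], [([1], 156), ([1], 346)],
      [([0,1,-2], 137), ([0,0,1,-2], 256), ([0,0,1,-2], 345)], [([1], 167), ([1,-1], 456)],
      [([0,0,0,-2,7,-6], 2345)], [([0,0,-2,3], 2456), ([0,0,2,-3], 1356)],
      [([0,0,0,-2,7,-6], 2347), ([0,0,0,-2,7,-6], 2356)], [([0,0,0,1,-2], 2357)],
      [([0,0,0,-4,6], 1367), ([0,0,-2,7,-6], 1457), ([0,0,0,-2,7,-6], 3456)],
      [([0,1], 1367), ([-1,2], 1457), ([0,-1,2], 3456)],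
      [([0,0,1,-2], 2367), ([0,-1,2], 1357), ([0,1,-1,-2], 2457)], [([1], 1467)],
      [([0,0,0,-2,7,-6], 23456)], [([0,0,0,-2,7,-6], 12357)], [([0,0,0,1,-2], 23457)],
      [([0,0,1,-2], 23467), ([0,-1,2], 13457)], [([-2,3], 14567)],
      [([0,1,-2], 24567), ([0,-1,2], 13567)], [([0,0,0,-2,7,-6], 123567)], [([0,1,-2], 134567)],
      [([0,0,0,1,-2], 234567)], [([0,0,0,-2,7,-6], 1234567)]]
    [([([1], 7)], 12567), ([([1], 6)], 23567), ([([1], 3)], 34567), ([([1], 5)], 24567),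
      ([([1], 57)], 1347), ([([1], 56)], 2457), ([([1], 37)], 1457), ([([1], 67)], 2347),
      ([([1], 47)], 1357), ([([1], 35)], 3467), ([([1], 27), ([-1], 35)], 1567),
      ([([1], 17)], 3457), ([([1], 45)], 2567), ([([1], 25)], 4567), ([([1], 34)], 3567),
      ([([1], 257)], 167), ([([1], 357)], 346), ([([1], 367)], 247), ([([1], 567)], 127),
      ([([1], 457)], 256), ([([1], 356)], 267), ([([1], 267)], 356),
      ([([1], 347), ([1], 356), ([-1], 267)], 347),
      ([([1], 157), ([1], 356), ([1,-1], 267), ([0,1], 347)], 157), ([([1], 456)], 257),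
      ([([1], 256)], 457), ([([1], 236)], 567), ([([1], 237)], 467), ([([1], 247)], 367),
      ([([1], 346)], 357), ([([1], 467)], 237), ([([1], 2567)], 45), ([([1], 3567)], 15),
      ([([1], 3457)], 17), ([([1], 3467)], 35), ([([1], 1567), ([1], 3467)], 27),
      ([([1], 2367)], 47), ([([1], 2457)], 56), ([([1], 4567)], 25), ([([1], 2347)], 67),
      ([([1], 1267)], 57), ([([1], 1457)], 37), ([([1], 13457)], 7), ([([1], 13567)], 5),
      ([([1], 34567)], 3), ([([1], 23567)], 6)]

lemma valid_f1357M : f1357M.Valid where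
  trace := by decide +kernel
  cocycles := by decide +kernel
  triples := by decide +kernel
  dual := by decide +kernel
  triangular := by decide +kernel
  E_ne_zero := by decide +kernel
  card := by decide +kernel

/-- The certificate for `1357N`. A multiple of `23` added to `15 + 34`, and one of `235` subtracted
from `137 + 456`, make the products of these classes with the one-form `4` independent of `t`;
the dual classes in degrees 5 and 4 change accordingly. -/
def f1357N : Certificate 7 :=
  ofDigits
    ![[], [], [([1], 0, 1)], [], [([1], 0, 2), ([1], 1, 3)], [([1], 0, 3)],
      [([1], 0, 4), ([0,1], 1, 2), ([1], 2, 3), ([1], 3, 5)]]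
    [1]
    [[([1], 1)], [([1], 2)], [([1], 4)], [([1], 13)], [([1], 23)],
      [([1], 15), ([1], 34), ([0,1], 23)], [([1], 16)], [([1], 26), ([-1], 34)], [([1], 234)],
      [([1], 235)], [([1], 245), ([-1], 135)], [([1], 236), ([1], 135)], [([1], 156), ([1], 346)],
      [([1], 137), ([1], 456), ([0,-1], 235)],
      [([1], 167), ([1], 456), ([0,-1], 256), ([0,-1], 345)], [([1], 2345)],
      [([1], 2456), ([-1], 1356)], [([1], 2347), ([1], 2356)], [([1], 1457), ([0,-1], 2356)],
      [([1], 1367)], [([1], 1467), ([0,-1], 2456)],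
      [([1], 1567), ([1], 3467), ([-2,-1], 2457), ([2], 1357), ([0,-1], 2367)], [([1], 13457)],
      [([1], 23457)], [([1], 23467), ([-1], 12357)], [([1], 14567), ([0,1], 23467)],
      [([1], 24567), ([-1], 13567)], [([1], 123567)], [([1], 134567)], [([1], 234567)],
      [([1], 1234567)]]
    [([([1], 7)], 12567), ([([1], 6)], 23567), ([([1], 3)], 34567), ([([1], 5)], 24567),
      ([([1], 67)], 2347), ([([1], 36)], 3457), ([([1], 37)], 2467), ([([1], 57)], 1267),
      ([([1], 17)], 2357), ([([1], 56)], 2457), ([([1], 27)], 1357), ([([1], 35)], 3467),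
      ([([1], 47)], 1567), ([([1], 45)], 2567), ([([1], 15)], 3567), ([([1], 25)], 4567),
      ([([1], 257)], 456), ([([1], 567)], 135), ([([1], 357)], 127), ([([1], 367)], 247),
      ([([1], 457)], 256), ([([1], 347)], 267), ([([1], 467)], 237), ([([1], 237)], 467),
      ([([1], 267)], 347), ([([1], 356), ([1], 347), ([1], 267)], 356),
      ([([1], 157), ([-1], 467), ([0,-1], 237), ([1], 356), ([1], 267)], 157),
      ([([1], 256)], 457), ([([1], 456)], 257), ([([1], 236)], 567), ([([1], 346)], 357),
      ([([1], 345)], 367), ([([1], 2567)], 45), ([([1], 4567)], 25), ([([1], 3567)], 15),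
      ([([1], 3467)], 35), ([([1], 2357)], 17), ([([1], 2367)], 47), ([([1], 3457)], 36),
      ([([1], 1257)], 37), ([([1], 1357)], 27), ([([1], 2457)], 56), ([([1], 1267)], 57),
      ([([1], 1457)], 67), ([([1], 34567)], 3), ([([1], 12567)], 7), ([([1], 24567)], 5),
      ([([1], 23567)], 6)]

lemma valid_f1357N : f1357N.Valid where
  trace := by decide +kernel
  cocycles := by decide +kernel
  triples := by decide +kernel
  dual := by decide +kernel
  triangular := by decide +kernel
  E_ne_zero := by decide +kernel
  card := by decide +kernel

end Certificate

namespace NilFamily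

/-- The certificate of a family. -/
def certificate : NilFamily → Certificate 7
  | f123457I => Certificate.f123457I
  | f12457N => Certificate.f12457N
  | f12457N₂ => Certificate.f12457N₂
  | f1357M => Certificate.f1357M
  | f1357N => Certificate.f1357N

lemma valid_certificate (F : NilFamily) : F.certificate.Valid := by
  cases F
  · exact Certificate.valid_f123457I
  · exact Certificate.valid_f12457N
  · exact Certificate.valid_f12457N₂
  · exact Certificate.valid_f1357M
  · exact Certificate.valid_f1357N

lemma bracket_eq_bracketCoord (F : NilFamily) (t : ℝ) (x y : Fin 7 → ℝ) (k : Fin 7) :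
    F.bracket t x y k = F.certificate.bracketCoord t k x y := by
  cases F <;> fin_cases k <;>
    simp [bracket, certificate, Certificate.bracketCoord, Certificate.ofDigits,
      Certificate.f123457I, Certificate.f12457N, Certificate.f12457N₂, Certificate.f1357M,
      Certificate.f1357N] <;> ring

/-- The basis `x₁, …, x₇`. -/
def basis (F : NilFamily) (t : ℝ) : Module.Basis (Fin 7) ℝ (F.LieAlg t) :=
  (Pi.basisFun ℝ (Fin 7) : Module.Basis (Fin 7) ℝ (Fin 7 → ℝ))

lemma d_gen (F : NilFamily) (t : ℝ) (k : Fin 7) :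
    LieCohomology.d (F.LieAlg t) (Form.gen (F.basis t) k) =
      Form.eval (F.basis t) t (F.certificate.D k) := by
  refine Certificate.d_gen_of_bracketCoord (F.basis t) k fun i j => ?_
  have h : ∀ i, F.basis t i = (Pi.single i 1 : Fin 7 → ℝ) := fun i => Pi.basisFun_apply ℝ _ i
  rw [h, h, ← bracket_eq_bracketCoord]
  rfl

end NilFamily

end

/-- Within each of the families `123457I`, `12457N`, `12457N₂`, `1357M`, `1357N`, all but finitely
many members have pairwise isomorphic real cohomology algebras. -/
theorem mainTheorem5 (F : NilFamily) :
    ∃ S : Set ℝ, S.Finite ∧ ∀ s ∈ F.params \ S, ∀ t ∈ F.params \ S,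
      LieCohomology.IsomorphicCohomology (F.LieAlg s) (F.LieAlg t) :=
  ⟨F.certificate.exceptional, F.valid_certificate.finite_exceptional, fun _ hs _ ht =>
    F.valid_certificate.isomorphicCohomology F.basis F.d_gen hs.2 ht.2⟩
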